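/- Let $d\ge 1$. For $n\in\mathbb N$, $n\ge 1$, let $\mathbb Z_n^d=(\mathbb Z/n\mathbb Z)^d$ be the discrete torus of side length $n$ (identified, where needed, with its representatives in $(-n/2,n/2]^d\cap\mathbb Z^d$), and let $\mathbb T^d=\mathbb R^d/\mathbb Z^d$ with normalised Lebesgue measure. Let $(\sigma_n(x))_{x\in\mathbb Z_n^d}$ be a centered jointly Gaussian family with stationary covariance $\mathbb E[\sigma_n(x)\sigma_n(y)]=K_n(x-y)$, and consider the divisible sandpile on $\mathbb Z_n^d$ with initial configuration $$s_n(x)=1+\sigma_n(x)-\frac1{n^d}\sum_{z\in\mathbb Z_n^d}\sigma_n(z).$$ At each discrete time step all vertices $x$ with mass $s(x)>1$ simultaneously topple: $x$ keeps mass $1$ and distributes the excess $s(x)-1$ uniformly among its $2d$ neighbours. The odometer $u_n(x)$ is the total mass emitted from $x$ over all time steps. Suppose that there is $K\in\ell^1(\mathbb Z^d)$ such that $K_n\to K$ in $\ell^1$, that is, $$\lim_{n\to\infty}\sum_{w\in\mathbb Z_n^d}|K_n(w)-K(w)|=0$$ (in particular $K_n\to K$ pointwise; this holds for instance when $K_n$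 is the restriction of $K$, or when $K_n\to K$ pointwise and the $|K_n|$ are dominated by a fixed summable function on $\mathbb Z^d$), and that $C_K:=\sum_{z\in\mathbb Z^d}K(z)\neq 0$. Put $b_n:=4\pi^2(2d)^{-1}n^{(d-4)/2}C_K^{-1/2}$ and $$\Xi_n(x):=\sum_{k\in\mathbb Z_n^d}u_n(k)\,\mathbf 1_{B(k/n,\,1/(2n))}(x),\qquad x\in\mathbb T^d,$$ where $B(z,\rho)$ is the ball of radius $\rho$ in the $\ell^\infty$-metric of $\mathbb T^d$. For $\varepsilon>0$ let $H^{-\varepsilon}(\mathbb T^d)$ be the Hilbert space completion of the real smooth functions on $\mathbb T^d$ with mean zero (equivalently, modulo constants) under $\|f\|_{-\varepsilon}^2=\sum_{\xi\in\mathbb Z^d\setminus\{0\}}\|\xi\|^{-4\varepsilon}|\widehat f(\xi)|^2$, where $\widehat f(\xi)=\int_{\mathbb T^d}f(z)e^{-2\pi i\xi\cdot z}\,dz$ and $\|\xi\|$ is the Euclidean norm. Then the odometers are finite, and for every $\varepsilon>\max\{d/2,\ d/4+1\}$ the fields $b_n\Xi_n$ converge in law in $H^{-\varepsilon}(\mathbb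 T^d)$, as $n\to\infty$, to the bi-Laplacian field $FGF_2(\mathbb T^d)$, that is, to the random element $\Xi$ of $H^{-\varepsilon}(\mathbb T^d)$ with Gaussian law and characteristic functional $$\mathbb E\big[e^{i\langle\Xi,f\rangle}\big]=\exp\Big(-\tfrac12\sum_{\xi\in\mathbb Z^d\setminus\{0\}}\|\xi\|^{-4}|\widehat f(\xi)|^2\Big)$$ for all smooth real $f$ on $\mathbb T^d$ with mean zero (in particular such a law exists). -/

import Mathlib

open MeasureTheory ProbabilityTheory Filter Topology
open scoped NNReal ComplexConjugate

noncomputable section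

namespace Sandpile

/-! ### The discrete torus and the divisible sandpile -/

/-- The discrete torus of side length `n` in dimension `d`. -/
abbrev DTorus (d n : ℕ) : Type := Fin d → ZMod n

/-- The `i`-th coordinate vector of the discrete torus. -/
def unitVec (d n : ℕ) (i : Fin d) : DTorus d n := Pi.single i 1

/-- The mass in excess of `1` at the vertex `x`. -/
def excess {d n : ℕ} (s : DTorus d n → ℝ) (x : DTorus d n) : ℝ := max (s x - 1) 0

/-- One time step: all unstable vertices topple simultaneously, each of them keeping mass `1` and
sending a fraction `1 / (2d)` of its excess in each of the `2d` coordinate directions. -/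
def topple {d n : ℕ} (s : DTorus d n → ℝ) (x : DTorus d n) : ℝ :=
  s x - excess s x
    + (2 * (d : ℝ))⁻¹ * ∑ i, (excess s (x + unitVec d n i) + excess s (x - unitVec d n i))

/-- The mass emitted from `x` in the time step from `t` to `t + 1`, started from `s`. -/
def emitted {d n : ℕ} (s : DTorus d n → ℝ) (t : ℕ) (x : DTorus d n) : ℝ :=
  excess (topple^[t] s) x

/-- The odometer: the total mass emitted from `x` during stabilization. -/
def odometer {d n : ℕ} (s : DTorus d n → ℝ) (x : DTorus d n) : ℝ := ∑' t, emitted s t x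

/-- The initial configuration `s(x) = 1 + σ(x) - n⁻ᵈ ∑ σ(z)`. -/
def initialConfig {d n : ℕ} [NeZero n] (σ : DTorus d n → ℝ) (x : DTorus d n) : ℝ :=
  1 + σ x - ((n : ℝ) ^ d)⁻¹ * ∑ z, σ z

/-- The representative in `(-n/2, n/2]ᵈ` of a point of the discrete torus. -/
def centeredRep {d n : ℕ} (x : DTorus d n) : Fin d → ℤ := fun i => (x i).valMinAbs

/-! ### The continuum torus -/

/-- The continuum torus `ℝᵈ / ℤᵈ`; its distance is the `ℓ^∞` distance modulo `ℤᵈ`. -/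
abbrev Torus (d : ℕ) : Type := UnitAddTorus (Fin d)

/-- Lebesgue measure on the torus (of total mass `1`). -/
def torusMeasure (d : ℕ) : Measure (Torus d) := Measure.pi fun _ => AddCircle.haarAddCircle

instance (d : ℕ) : IsProbabilityMeasure (torusMeasure d) := by
  unfold torusMeasure; infer_instance

/-- The Fourier coefficient `∫ f(z) exp(-2πi ξ·z) dz` of a real function on the torus. -/
def fourierCoef {d : ℕ} (f : Torus d → ℝ) (ξ : Fin d → ℤ) : ℂ :=
  ∫ z, UnitAddTorus.mFourier (-ξ) z * (f z : ℂ) ∂(torusMeasure d)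

/-- The point `k / n` of the torus, for `k` in the discrete torus. -/
def gridPoint {d n : ℕ} [NeZero n] (k : DTorus d n) : Torus d := fun i => ZMod.toAddCircle (k i)

/-- The piecewise constant interpolation of `u` on the boxes of radius `1 / (2n)` around the
points of the rescaled grid. -/
def interpolation {d n : ℕ} [NeZero n] (u : DTorus d n → ℝ) (x : Torus d) : ℝ :=
  ∑ k, u k * (Metric.ball (gridPoint k) (1 / (2 * (n : ℝ)))).indicator (fun _ => 1) x

theorem memLp_interpolation {d n : ℕ} [NeZero n] (u : DTorus d n → ℝ) :
    MemLp (interpolation u) 2 (torusMeasure d) := by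
  unfold interpolation
  refine memLp_finsetSum _ fun k _ => ?_
  refine MemLp.const_mul ?_ _
  exact (memLp_const 1).indicator measurableSet_ball

/-! ### Sobolev spaces on the torus -/

/-- The nonzero frequencies. -/
abbrev Freq (d : ℕ) : Type := {ξ : Fin d → ℤ // ξ ≠ 0}

/-- The opposite frequency. -/
def Freq.opp {d : ℕ} (ξ : Freq d) : Freq d := ⟨-ξ.1, neg_ne_zero.2 ξ.2⟩

/-- The Euclidean norm of a frequency. -/
def Freq.len {d : ℕ} (ξ : Freq d) : ℝ := Real.sqrt (∑ i, (ξ.1 i : ℝ) ^ 2)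

theorem Freq.one_le_len {d : ℕ} (ξ : Freq d) : 1 ≤ ξ.len := by
  obtain ⟨i, hi⟩ := Function.ne_iff.1 ξ.2
  have h1 : (1 : ℝ) ≤ (ξ.1 i : ℝ) ^ 2 := by
    have : (1 : ℤ) ≤ (ξ.1 i) ^ 2 := by
      have := sq_pos_of_ne_zero (a := ξ.1 i) hi
      omega
    exact_mod_cast this
  refine Real.one_le_sqrt.2 (h1.trans ?_)
  exact Finset.single_le_sum (f := fun i => (ξ.1 i : ℝ) ^ 2) (fun _ _ => sq_nonneg _)
    (Finset.mem_univ i)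

/-- The sequence `ξ ↦ ‖ξ‖^(-2ε) c(ξ)`. -/
def weighted {d : ℕ} (ε : ℝ≥0) (c : Freq d → ℂ) (ξ : Freq d) : ℂ :=
  ((ξ.len ^ (-2 * (ε : ℝ)) : ℝ) : ℂ) * c ξ

theorem norm_weighted_sq {d : ℕ} (ε : ℝ≥0) (c : Freq d → ℂ) (ξ : Freq d) :
    ‖weighted ε c ξ‖ ^ 2 = ξ.len ^ (-4 * (ε : ℝ)) * ‖c ξ‖ ^ 2 := by
  have h : 0 ≤ ξ.len := zero_le_one.trans ξ.one_le_len
  unfold weighted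
  rw [norm_mul, mul_pow, Complex.norm_real, Real.norm_eq_abs, sq_abs, ← Real.rpow_natCast,
    ← Real.rpow_mul h]
  congr 2
  push_cast
  ring

theorem memlp_weighted_iff {d : ℕ} (ε : ℝ≥0) (c : Freq d → ℂ) :
    Memℓp (weighted ε c) 2 ↔ Summable fun ξ : Freq d => ξ.len ^ (-4 * (ε : ℝ)) * ‖c ξ‖ ^ 2 := by
  rw [memℓp_gen_iff (by norm_num)]
  simp only [ENNReal.toReal_ofNat, Real.rpow_ofNat, norm_weighted_sq]

/-- The families of Fourier coefficients of the real distributions modulo constants on the torus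
that have finite norm `(∑ ‖ξ‖^(-4ε) |c(ξ)|²)^(1/2)`. -/
def negSobolevSubmodule (d : ℕ) (ε : ℝ≥0) : Submodule ℝ (Freq d → ℂ) where
  carrier := {c | (∀ ξ : Freq d, c ξ.opp = conj (c ξ)) ∧
    Summable fun ξ : Freq d => ξ.len ^ (-4 * (ε : ℝ)) * ‖c ξ‖ ^ 2}
  zero_mem' := by
    constructor <;> simp
  add_mem' := by
    rintro a b ⟨ha, ha'⟩ ⟨hb, hb'⟩
    refine ⟨fun ξ => by simp [ha, hb], ?_⟩
    rw [← memlp_weighted_iff] at *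
    have : weighted ε (a + b) = weighted ε a + weighted ε b := by
      ext ξ; simp [weighted, mul_add]
    rw [this]
    exact ha'.add hb'
  smul_mem' := by
    rintro r a ⟨ha, ha'⟩
    refine ⟨fun ξ => by simp [ha], ?_⟩
    refine (ha'.mul_left (r ^ 2)).congr fun ξ => ?_
    simp only [Pi.smul_apply, norm_smul, mul_pow, Real.norm_eq_abs, sq_abs]
    ring

/-- The Sobolev space `H^{-ε}` of the torus: the completion of the smooth real functions with mean
zero under the norm `‖f‖² = ∑_{ξ ≠ 0} ‖ξ‖^(-4ε) |f̂(ξ)|²`. An element is given by its Fourier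
coefficients at the nonzero frequencies. -/
def NegSobolev (d : ℕ) (ε : ℝ≥0) : Type := negSobolevSubmodule d ε

namespace NegSobolev

variable {d : ℕ} {ε : ℝ≥0}

instance : AddCommGroup (NegSobolev d ε) :=
  inferInstanceAs (AddCommGroup (negSobolevSubmodule d ε))

instance : Module ℝ (NegSobolev d ε) :=
  inferInstanceAs (Module ℝ (negSobolevSubmodule d ε))

/-- The Fourier coefficient of an element of `H^{-ε}`. -/
def coeff (h : NegSobolev d ε) (ξ : Freq d) : ℂ := h.1 ξ

/-- The linear map from `H^{-ε}` to `ℓ²` that defines the norm. -/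
def toEllTwo (d : ℕ) (ε : ℝ≥0) : NegSobolev d ε →ₗ[ℝ] lp (fun _ : Freq d => ℂ) 2 where
  toFun h := ⟨weighted ε h.coeff, (memlp_weighted_iff ε _).2 h.2.2⟩
  map_add' a b := by
    apply Subtype.ext
    funext ξ
    exact mul_add _ _ _
  map_smul' r a := by
    apply Subtype.ext
    funext ξ
    change _ * (r • a.coeff ξ) = r • (_ * a.coeff ξ)
    exact mul_smul_comm _ _ _

theorem toEllTwo_injective : Function.Injective (toEllTwo d ε) := by
  intro a b hab
  apply Subtype.ext
  funext ξ
  have h := congrFun (congrArg Subtype.val hab) ξ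
  refine mul_left_cancel₀ ?_ h
  exact Complex.ofReal_ne_zero.2 (Real.rpow_pos_of_pos (zero_lt_one.trans_le ξ.one_le_len) _).ne'

instance : NormedAddCommGroup (NegSobolev d ε) :=
  NormedAddCommGroup.induced (NegSobolev d ε) (lp (fun _ : Freq d => ℂ) 2) (toEllTwo d ε)
    toEllTwo_injective

instance : NormedSpace ℝ (NegSobolev d ε) :=
  NormedSpace.induced ℝ (NegSobolev d ε) (lp (fun _ : Freq d => ℂ) 2) (toEllTwo d ε)

theorem norm_sq (h : NegSobolev d ε) :
    ‖h‖ ^ 2 = ∑' ξ : Freq d, ξ.len ^ (-4 * (ε : ℝ)) * ‖h.coeff ξ‖ ^ 2 := by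
  have h1 : ‖h‖ = ‖toEllTwo d ε h‖ := rfl
  have h2 := lp.norm_rpow_eq_tsum (p := 2) (by norm_num) (toEllTwo d ε h)
  simp only [ENNReal.toReal_ofNat, Real.rpow_ofNat] at h2
  rw [h1, h2]
  exact tsum_congr fun ξ => norm_weighted_sq ε _ ξ

instance : MeasurableSpace (NegSobolev d ε) := borel _

instance : BorelSpace (NegSobolev d ε) := ⟨rfl⟩

end NegSobolev

theorem fourierCoef_mem {d : ℕ} (ε : ℝ≥0) {f : Torus d → ℝ} (hf : MemLp f 2 (torusMeasure d)) :
    (fun ξ : Freq d => fourierCoef f ξ.1) ∈ negSobolevSubmodule d ε := by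
  constructor
  · intro ξ
    change fourierCoef f (-ξ.1) = conj (fourierCoef f ξ.1)
    unfold fourierCoef
    rw [← integral_conj]
    refine integral_congr_ae (Eventually.of_forall fun z => ?_)
    simp [UnitAddTorus.mFourier_neg]
  · have hf' : MemLp (fun z => (f z : ℂ)) 2 (torusMeasure d) := hf.ofReal
    have hs := (UnitAddTorus.hasSum_sq_mFourierCoeff (hf'.toLp _)).summable
    have hs' : Summable fun ξ : Freq d => ‖fourierCoef f ξ.1‖ ^ 2 := by
      refine (hs.comp_injective (Subtype.val_injective (p := fun ξ : Fin d → ℤ => ξ ≠ 0))).congr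
        fun ξ => ?_
      simp only [Function.comp]
      congr 2
      refine integral_congr_ae ?_
      filter_upwards [hf'.coeFn_toLp] with z hz
      exact congrArg (fun w => UnitAddTorus.mFourier (-ξ.1) z * w) hz
    refine hs'.of_nonneg_of_le (fun ξ => ?_) (fun ξ => ?_)
    · have h : 0 ≤ ξ.len := zero_le_one.trans ξ.one_le_len
      positivity
    · refine mul_le_of_le_one_left (sq_nonneg _) ?_
      exact Real.rpow_le_one_of_one_le_of_nonpos ξ.one_le_len (by simp)

/-- The element of `H^{-ε}` (hence modulo constants) given by a square integrable function. -/
def NegSobolev.ofMemLp {d : ℕ} (ε : ℝ≥0) {f : Torus d → ℝ} (hf : MemLp f 2 (torusMeasure d)) :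
    NegSobolev d ε :=
  ⟨fun ξ => fourierCoef f ξ.1, fourierCoef_mem ε hf⟩

/-- The formal field `Ξ` of an odometer `u`, as an element of `H^{-ε}`. -/
def field {d n : ℕ} [NeZero n] (ε : ℝ≥0) (u : DTorus d n → ℝ) : NegSobolev d ε :=
  NegSobolev.ofMemLp ε (memLp_interpolation u)

/-! ### The limiting field -/

/-- Test functions: smooth real functions on the torus with mean zero. -/
structure IsTest {d : ℕ} (f : Torus d → ℝ) : Prop where
  smooth : ContDiff ℝ (⊤ : ℕ∞) fun x : Fin d → ℝ => f fun i => (x i : UnitAddCircle)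
  mean_zero : ∫ z, f z ∂(torusMeasure d) = 0

/-- The duality pairing `⟨h, f⟩ = ∑_{ξ ≠ 0} ĥ(ξ) conj(f̂(ξ))` of `h` in `H^{-ε}` with a test
function; for `h` square integrable it is the integral of `h f`. -/
def pairing {d : ℕ} {ε : ℝ≥0} (h : NegSobolev d ε) (f : Torus d → ℝ) : ℝ :=
  ∑' ξ : Freq d, (h.coeff ξ * conj (fourierCoef f ξ.1)).re

/-- `μ` is the law of the bi-Laplacian field `FGF₂` on the torus: the Gaussian law on `H^{-ε}` with
characteristic functional `f ↦ exp(-½ ∑_{ξ ≠ 0} ‖ξ‖⁻⁴ |f̂(ξ)|²)`. -/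
structure IsFGF2 {d : ℕ} {ε : ℝ≥0} (μ : Measure (NegSobolev d ε)) : Prop where
  gaussian : IsGaussian μ
  charFunctional : ∀ f : Torus d → ℝ, IsTest f →
    ∫ h, Complex.exp (Complex.I * (pairing h f : ℂ)) ∂μ
      = Complex.exp
          ((-(1 / 2) * ∑' ξ : Freq d, ξ.len ^ (-4 : ℝ) * ‖fourierCoef f ξ.1‖ ^ 2 : ℝ) : ℂ)

end Sandpile

end

/-!
The proof is Fourier analysis for a linear image of a Gaussian vector.

*Linearity.* A configuration of total mass `n ^ d` stabilizes to the constant `1`: a nonnegative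
solution `v` of the Poisson equation `lap v = 1 - s` exists and dominates the emitted mass at all
times (`sum_emitted_le`), so the odometer `u` is finite and satisfies `lap u = 1 - s` as well
(`lap_odometer`). At the nonzero frequencies `u` is therefore a Fourier multiplier applied to the
weights `σ`. Together with the Fourier coefficients of a box this gives the coefficients of the
interpolated field explicitly (`coeff_field_odometer`). At the nonzero frequencies in `nℤᵈ`, which
the discrete Laplacian does not see, the coefficients of a box vanish.

*Real coordinates.* The Hartley coefficients `Re ĥ(ξ) + Im ĥ(ξ)`, weighted by `‖ξ‖^(-2ε)`, identify
`H^{-ε}` isometrically with a real `ℓ²` space (`ofHartley`, `toHartley`), on which the limiting law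
has independent coordinates of variances `‖ξ‖^(-4-4ε)` (`exists_hartley_FGF2`). It is constructed as
the law of a random series with independent Gaussian coefficients (`exists_gaussian_diagonal`).
Fourier coefficients of smooth functions decay rapidly, so the pairing with a test function is an
inner product in `ℓ²`.

*Covariances.* By stationarity the covariance of two Hartley coefficients of `σ` is `n ^ d` times
the discrete Fourier transform of `Kn`, up to indicators of `ξ = ±η` modulo `n`
(`integral_dht_mul_dht`). At a fixed frequency this transform tends to `∑ K`, since `Kn → K` in `ℓ¹`
and the frequency `ξ / n` tends to `0` (`tendsto_dft_kernel`); hence the covariances converge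
(`tendsto_covariance`). As `|sin (π m / n)| ≥ 2 / n` unless `n ∣ m`, the variances are bounded by
a constant times `‖ξ‖^(-4ε)`, uniformly in `n` (`eventually_lintegral_sq_le`), and this is summable
because `4ε > d`.

*Weak convergence.* Convergence of the characteristic functions of finitely many coordinates and
a uniform summable bound on the second moments give weak convergence in a Hilbert space, by
truncation, Lévy's theorem in finite dimensions and Lipschitz test functions
(`tendsto_of_tendsto_charFun_of_moment_le`).
-/

noncomputable section

namespace Sandpile

/-! ### The graph Laplacian and stabilization -/

section Laplacian

variable {d n : ℕ}

/-- The normalized graph Laplacian of the discrete torus: the average over the `2d` neighbours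
minus the value. -/
def lap (d n : ℕ) : (DTorus d n → ℝ) →ₗ[ℝ] (DTorus d n → ℝ) where
  toFun v x := (2 * (d : ℝ))⁻¹ * ∑ i, (v (x + unitVec d n i) + v (x - unitVec d n i)) - v x
  map_add' v w := by
    funext x
    simp only [Pi.add_apply]
    rw [show ∑ i, (v (x + unitVec d n i) + w (x + unitVec d n i)
        + (v (x - unitVec d n i) + w (x - unitVec d n i)))
        = ∑ i, (v (x + unitVec d n i) + v (x - unitVec d n i))
          + ∑ i, (w (x + unitVec d n i) + w (x - unitVec d n i)) by
      rw [← Finset.sum_add_distrib]; exact Finset.sum_congr rfl fun i _ => by ring]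
    ring
  map_smul' r v := by
    funext x
    simp only [Pi.smul_apply, smul_eq_mul, RingHom.id_apply, ← mul_add, ← Finset.mul_sum]
    ring

theorem lap_apply (v : DTorus d n → ℝ) (x : DTorus d n) :
    lap d n v x = (2 * (d : ℝ))⁻¹ * ∑ i, (v (x + unitVec d n i) + v (x - unitVec d n i)) - v x :=
  rfl

theorem topple_eq (s : DTorus d n → ℝ) : topple s = s + lap d n (excess s) := by
  funext x
  simp only [topple, Pi.add_apply, lap_apply]
  ring

/-- The configuration at time `t` depends only on the total mass emitted so far. -/
theorem iterate_topple_eq (s : DTorus d n → ℝ) (t : ℕ) :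
    topple^[t] s = s + lap d n (∑ j ∈ Finset.range t, emitted s j) := by
  induction t with
  | zero => simp
  | succ t ih =>
    rw [Function.iterate_succ_apply', topple_eq, Finset.sum_range_succ, map_add, ← add_assoc, ← ih]
    rfl

/-- Abelian comparison principle: the mass emitted up to time `t` is dominated by every nonnegative
`v` whose toppling would leave at most mass `1` at each vertex. -/
theorem sum_emitted_le {s v : DTorus d n → ℝ} (hv : ∀ x, 0 ≤ v x)
    (hs : ∀ x, s x + lap d n v x ≤ 1) (t : ℕ) (x : DTorus d n) :
    ∑ j ∈ Finset.range t, emitted s j x ≤ v x := by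
  induction t generalizing x with
  | zero => simpa using hv x
  | succ t ih =>
    rw [Finset.sum_range_succ]
    rcases le_total (topple^[t] s x) 1 with h | h
    · have : emitted s t x = 0 := max_eq_right (by linarith)
      rw [this, add_zero]
      exact ih x
    -- an unstable vertex ends with the neighbour average of the mass emitted before, plus `s x - 1`
    · have h1 : emitted s t x = topple^[t] s x - 1 := max_eq_left (by linarith)
      rw [h1, iterate_topple_eq, Pi.add_apply, lap_apply]
      simp only [Finset.sum_apply]
      have h2 := hs x
      rw [lap_apply] at h2
      have h3 : (2 * (d : ℝ))⁻¹ * ∑ i, (∑ j ∈ Finset.range t, emitted s j (x + unitVec d n i)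
            + ∑ j ∈ Finset.range t, emitted s j (x - unitVec d n i))
          ≤ (2 * (d : ℝ))⁻¹ * ∑ i, (v (x + unitVec d n i) + v (x - unitVec d n i)) := by
        gcongr with i
        · exact ih _
        · exact ih _
      linarith

theorem emitted_nonneg (s : DTorus d n → ℝ) (t : ℕ) (x : DTorus d n) : 0 ≤ emitted s t x :=
  le_max_right _ _

theorem summable_emitted {s v : DTorus d n → ℝ} (hv : ∀ x, 0 ≤ v x)
    (hs : ∀ x, s x + lap d n v x ≤ 1) (x : DTorus d n) : Summable fun t => emitted s t x :=
  summable_of_sum_range_le (fun t => emitted_nonneg s t x) fun t => sum_emitted_le hv hs t x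

theorem eq_of_forall_add_unitVec [NeZero n] {f : DTorus d n → ℝ}
    (h : ∀ x i, f (x + unitVec d n i) = f x) (x : DTorus d n) : f x = f 0 := by
  have h1 : ∀ (i : Fin d) (m : ℕ) (y : DTorus d n), f (y + Pi.single i (m : ZMod n)) = f y := by
    intro i m
    induction m with
    | zero => intro y; simp
    | succ m ih =>
      intro y
      rw [Nat.cast_succ, Pi.single_add, ← add_assoc]
      exact (h _ i).trans (ih y)
  have h2 : ∀ (t : Finset (Fin d)), f (∑ i ∈ t, Pi.single i (x i)) = f 0 := by
    intro t
    induction t using Finset.induction_on with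
    | empty => simp
    | insert i t hi ih =>
      rw [Finset.sum_insert hi, add_comm]
      have := h1 i (x i).val (∑ i ∈ t, Pi.single i (x i))
      rw [ZMod.natCast_zmod_val] at this
      rw [this, ih]
  rw [← h2 Finset.univ, Finset.univ_sum_single]

theorem sum_comp_add_unitVec [NeZero n] (f : DTorus d n → ℝ) (i : Fin d) :
    ∑ x, f (x + unitVec d n i) = ∑ x, f x :=
  Equiv.sum_comp (Equiv.addRight (unitVec d n i)) f

theorem sum_comp_sub_unitVec [NeZero n] (f : DTorus d n → ℝ) (i : Fin d) :
    ∑ x, f (x - unitVec d n i) = ∑ x, f x :=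
  Equiv.sum_comp (Equiv.subRight (unitVec d n i)) f

theorem sum_lap [NeZero n] (hd : 1 ≤ d) (v : DTorus d n → ℝ) : ∑ x, lap d n v x = 0 := by
  simp only [lap_apply, Finset.sum_sub_distrib, ← Finset.mul_sum]
  rw [Finset.sum_comm]
  simp only [Finset.sum_add_distrib, sum_comp_add_unitVec, sum_comp_sub_unitVec, Finset.sum_const,
    Finset.card_univ, Fintype.card_fin, nsmul_eq_mul]
  have : (d : ℝ) ≠ 0 := by positivity
  field_simp
  ring

/-- The Dirichlet energy identity. -/
theorem sum_mul_lap [NeZero n] (hd : 1 ≤ d) (v : DTorus d n → ℝ) :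
    ∑ x, v x * lap d n v x
      = -(2 * (d : ℝ))⁻¹ * ∑ i, ∑ x, (v (x + unitVec d n i) - v x) ^ 2 := by
  have hd' : (d : ℝ) ≠ 0 := by positivity
  have h1 : ∀ i : Fin d, ∑ x, (v (x + unitVec d n i) - v x) ^ 2
      = 2 * ∑ x, v x ^ 2 - ∑ x, v x * (v (x + unitVec d n i) + v (x - unitVec d n i)) := by
    intro i
    have e1 := sum_comp_add_unitVec (fun x => v x ^ 2) i
    have e2 := sum_comp_add_unitVec (fun x => v x * v (x - unitVec d n i)) i
    simp only [add_sub_cancel_right] at e2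
    simp only [mul_add, Finset.sum_add_distrib]
    rw [← e2, two_mul]
    nth_rewrite 1 [← e1]
    rw [← Finset.sum_add_distrib, ← Finset.sum_add_distrib, ← Finset.sum_sub_distrib]
    exact Finset.sum_congr rfl fun x _ => by ring
  simp only [h1, Finset.sum_sub_distrib, Finset.sum_const, Finset.card_univ, Fintype.card_fin,
    nsmul_eq_mul]
  rw [Finset.sum_comm]
  simp only [lap_apply, mul_sub, Finset.sum_sub_distrib, ← Finset.mul_sum]
  simp only [mul_left_comm _ (2 * (d : ℝ))⁻¹ _, ← Finset.mul_sum, ← pow_two]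
  field_simp
  ring

theorem eq_of_lap_eq_zero [NeZero n] (hd : 1 ≤ d) {v : DTorus d n → ℝ} (hv : lap d n v = 0)
    (x : DTorus d n) : v x = v 0 := by
  refine eq_of_forall_add_unitVec (fun x i => ?_) x
  have h := sum_mul_lap hd v
  simp only [hv, Pi.zero_apply, mul_zero, Finset.sum_const_zero] at h
  have hd' : (d : ℝ) ≠ 0 := by positivity
  have h0 : ∑ i, ∑ x, (v (x + unitVec d n i) - v x) ^ 2 = 0 := by
    rcases mul_eq_zero.1 h.symm with h | h
    · exact absurd h (by simp [hd'])
    · exact h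
  have h1 := (Finset.sum_eq_zero_iff_of_nonneg
    (fun i _ => Finset.sum_nonneg fun x _ => sq_nonneg _)).1 h0 i (Finset.mem_univ i)
  have h2 := (Finset.sum_eq_zero_iff_of_nonneg (fun x _ => sq_nonneg _)).1 h1 x (Finset.mem_univ x)
  exact sub_eq_zero.1 (pow_eq_zero_iff (by norm_num) |>.1 h2)

/-- The Poisson equation is solvable for every right-hand side of total mass zero: the kernel of
the Laplacian consists of the constants, so its range has codimension one. -/
theorem exists_lap_eq [NeZero n] (hd : 1 ≤ d) {f : DTorus d n → ℝ} (hf : ∑ x, f x = 0) :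
    ∃ v, lap d n v = f := by
  let φ : (DTorus d n → ℝ) →ₗ[ℝ] ℝ := ∑ x, LinearMap.proj x
  have hφ : ∀ g, φ g = ∑ x, g x := fun g => by simp [φ]
  have hle : LinearMap.range (lap d n) ≤ LinearMap.ker φ := by
    rintro _ ⟨v, rfl⟩
    rw [LinearMap.mem_ker, hφ, sum_lap hd]
  have hker : Module.finrank ℝ (LinearMap.ker (lap d n)) ≤ 1 := by
    refine finrank_le_one ⟨fun _ => 1, ?_⟩ fun w => ⟨w.1 0, ?_⟩
    · rw [LinearMap.mem_ker]
      funext x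
      have hd' : (d : ℝ) ≠ 0 := by positivity
      simp [lap_apply]
      field_simp
      norm_num
    · apply Subtype.ext
      funext x
      simp [eq_of_lap_eq_zero hd w.2 x]
  have hrφ : LinearMap.range φ = ⊤ := by
    rw [LinearMap.range_eq_top]
    intro r
    exact ⟨Pi.single 0 r, by rw [hφ]; simp⟩
  have h1 := LinearMap.finrank_range_add_finrank_ker (lap d n)
  have h2 := LinearMap.finrank_range_add_finrank_ker φ
  rw [hrφ, finrank_top, Module.finrank_self] at h2
  have heq := Submodule.eq_of_le_of_finrank_le hle (by omega)
  have : f ∈ LinearMap.range (lap d n) := by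
    rw [heq, LinearMap.mem_ker, hφ, hf]
  exact this

end Laplacian

section Stabilization

variable {d n : ℕ} [NeZero n]

/-- A configuration of total mass `n ^ d` is dominated in the sense of `sum_emitted_le`. -/
theorem exists_nonneg_lap_eq (hd : 1 ≤ d) {s : DTorus d n → ℝ} (hs : ∑ x, (s x - 1) = 0) :
    ∃ v : DTorus d n → ℝ, (∀ x, 0 ≤ v x) ∧ ∀ x, s x + lap d n v x = 1 := by
  obtain ⟨v, hv⟩ := exists_lap_eq hd (f := fun x => 1 - s x) (by
    rw [← neg_eq_zero, ← Finset.sum_neg_distrib]; simpa using hs)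
  obtain ⟨x₀, hx₀⟩ := Finite.exists_min v
  have hd' : (d : ℝ) ≠ 0 := by positivity
  have hc : lap d n (fun _ => v x₀) = 0 := by
    funext x
    simp [lap_apply]
    field_simp
    ring
  refine ⟨v - fun _ => v x₀, fun x => sub_nonneg.2 (hx₀ x), fun x => ?_⟩
  rw [map_sub, hc, hv]
  simp

/-- The odometer of a configuration of total mass `n ^ d` solves the Poisson equation that says that
the final configuration is identically `1`. -/
theorem lap_odometer (hd : 1 ≤ d) {s : DTorus d n → ℝ} (hs : ∑ x, (s x - 1) = 0)
    (x : DTorus d n) : lap d n (odometer s) x = 1 - s x := by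
  obtain ⟨v, hv, hsv⟩ := exists_nonneg_lap_eq hd hs
  have hsum : ∀ y, Summable fun t => emitted s t y := summable_emitted hv fun y => (hsv y).le
  have hlim : ∀ y, Tendsto (fun t => topple^[t] s y) atTop (𝓝 (s y + lap d n (odometer s) y)) := by
    intro y
    simp only [iterate_topple_eq, Pi.add_apply, lap_apply, Finset.sum_apply]
    have h := fun z => (hsum z).hasSum.tendsto_sum_nat
    refine tendsto_const_nhds.add ((Tendsto.const_mul _ ?_).sub (h y))
    exact tendsto_finsetSum _ fun i _ => (h _).add (h _)
  have hle : ∀ y, s y + lap d n (odometer s) y ≤ 1 := by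
    intro y
    have h0 := (hsum y).tendsto_atTop_zero
    have h1 : Tendsto (fun t => emitted s t y) atTop
        (𝓝 (max (s y + lap d n (odometer s) y - 1) 0)) :=
      ((hlim y).sub_const 1).max tendsto_const_nhds
    have := tendsto_nhds_unique h1 h0
    have := max_eq_right_iff.1 this
    linarith
  -- the total mass is conserved in the limit, so the bound by `1` is attained everywhere
  have htot : ∑ y, (1 - (s y + lap d n (odometer s) y)) = 0 := by
    have : ∑ y, (1 - (s y + lap d n (odometer s) y))
        = -∑ y, (s y - 1) - ∑ y, lap d n (odometer s) y := by
      rw [← Finset.sum_neg_distrib, ← Finset.sum_sub_distrib]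
      exact Finset.sum_congr rfl fun y _ => by ring
    rw [this, hs, sum_lap hd]
    simp
  have := (Finset.sum_eq_zero_iff_of_nonneg (fun y _ => sub_nonneg.2 (hle y))).1 htot x
    (Finset.mem_univ x)
  linarith

theorem sum_initialConfig_sub_one (σ : DTorus d n → ℝ) :
    ∑ x, (initialConfig σ x - 1) = 0 := by
  have hn : ((n : ℝ) ^ d) ≠ 0 := pow_ne_zero _ (Nat.cast_ne_zero.2 (NeZero.ne n))
  have hc : (Fintype.card (DTorus d n) : ℝ) = (n : ℝ) ^ d := by
    simp [ZMod.card]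
  simp only [initialConfig, add_sub_assoc]
  have : ∀ x, 1 + (σ x - ((n : ℝ) ^ d)⁻¹ * ∑ z, σ z - 1) = σ x - ((n : ℝ) ^ d)⁻¹ * ∑ z, σ z :=
    fun x => by ring
  simp only [this, Finset.sum_sub_distrib, Finset.sum_const, Finset.card_univ, nsmul_eq_mul]
  rw [hc, mul_inv_cancel_left₀ hn, sub_self]

end Stabilization

/-! ### Gaussian measures and weak convergence on a Hilbert space -/

section Hilbert

open scoped RealInnerProductSpace

variable {ι H : Type*} [NormedAddCommGroup H] [InnerProductSpace ℝ H]

theorem summable_smul_of_summable_sq (b : HilbertBasis ι ℝ H) {c : ι → ℝ}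
    (hc : Summable fun i => c i ^ 2) : Summable fun i => c i • b i := by
  have hm : Memℓp c 2 := by
    rw [memℓp_gen_iff (by norm_num)]
    simpa using hc
  exact (b.hasSum_repr_symm ⟨c, hm⟩).summable

/-- The characteristic functions of the partial sums of the random series. -/
theorem charFun_finsetSum_gaussian [Countable ι] (b : HilbertBasis ι ℝ H) (w : ι → ℝ) (y : H)
    (s : Finset ι) :
    ∫ g, Complex.exp (⟪∑ i ∈ s, (w i * g i) • b i, y⟫ * Complex.I)
        ∂(Measure.infinitePi fun _ : ι => gaussianReal 0 1)
      = Complex.exp ((-(∑ i ∈ s, (w i * ⟪b i, y⟫) ^ 2) / 2 : ℝ) : ℂ) := by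
  let f : (s → ℝ) → ℂ := fun g => ∏ i : s, Complex.exp ((w i * ⟪b i, y⟫ : ℝ) * g i * Complex.I)
  have h1 : ∀ g : ι → ℝ, Complex.exp (⟪∑ i ∈ s, (w i * g i) • b i, y⟫ * Complex.I)
      = f (s.restrict g) := by
    intro g
    simp only [f, ← Complex.exp_sum, Finset.restrict]
    congr 1
    rw [sum_inner, Finset.sum_coe_sort s
      (fun i => ((w i * ⟪b i, y⟫ : ℝ) : ℂ) * (g i : ℂ) * Complex.I), ← Finset.sum_mul]
    congr 1
    rw [Complex.ofReal_sum]
    refine Finset.sum_congr rfl fun i _ => ?_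
    rw [real_inner_smul_left]
    push_cast
    ring
  have hf : Continuous f := by fun_prop
  simp_rw [h1]
  rw [integral_restrict_infinitePi (μ := fun _ : ι => gaussianReal 0 1)
    hf.aestronglyMeasurable]
  rw [integral_fintype_prod_eq_prod (𝕜 := ℂ)
    (fun (i : s) (t : ℝ) => Complex.exp ((w i * ⟪b i, y⟫ : ℝ) * t * Complex.I))]
  have h2 : ∀ a : ℝ, ∫ t, Complex.exp (a * t * Complex.I) ∂(gaussianReal 0 1)
      = Complex.exp ((-(a ^ 2) / 2 : ℝ) : ℂ) := by
    intro a
    rw [← charFun_apply_real, charFun_gaussianReal]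
    congr 1
    push_cast
    ring
  simp_rw [h2]
  rw [Finset.prod_coe_sort s
    (fun i => Complex.exp ((-((w i * ⟪b i, y⟫) ^ 2) / 2 : ℝ) : ℂ)), ← Complex.exp_sum,
    ← Complex.ofReal_sum, neg_div, Finset.sum_div, ← Finset.sum_neg_distrib]
  simp only [neg_div]

/-- The finite-dimensional projection onto the span of the basis vectors in `s`. -/
def truncation (b : HilbertBasis ι ℝ H) (s : Finset ι) (x : H) : H := ∑ i ∈ s, ⟪b i, x⟫ • b i

theorem continuous_truncation (b : HilbertBasis ι ℝ H) (s : Finset ι) :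
    Continuous (truncation b s) := by
  unfold truncation; fun_prop

theorem tendsto_truncation (b : HilbertBasis ι ℝ H) (x : H) :
    Tendsto (fun s => truncation b s x) atTop (𝓝 x) := by
  have := b.hasSum_repr x
  simp only [b.repr_apply_apply] at this
  exact this

theorem norm_sub_truncation_sq (b : HilbertBasis ι ℝ H) (s : Finset ι) (x : H) :
    ENNReal.ofReal (‖x - truncation b s x‖ ^ 2)
      = ∑' i : {i // i ∉ s}, ENNReal.ofReal (⟪b i, x⟫ ^ 2) := by
  classical
  have h1 := b.hasSum_inner_mul_inner (x - truncation b s x) (x - truncation b s x)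
  have h2 : ∀ i, ⟪b i, x - truncation b s x⟫ = if i ∈ s then 0 else ⟪b i, x⟫ := by
    intro i
    rw [inner_sub_right, truncation, inner_sum]
    simp only [real_inner_smul_right, orthonormal_iff_ite.1 b.orthonormal, mul_ite, mul_one,
      mul_zero, Finset.sum_ite_eq]
    split_ifs <;> simp
  have h3 : ∀ i, ⟪x - truncation b s x, b i⟫ = if i ∈ s then 0 else ⟪b i, x⟫ := fun i => by
    rw [real_inner_comm, h2]
  have h4 : HasSum (fun i => (if i ∈ s then 0 else ⟪b i, x⟫) ^ 2)
      (‖x - truncation b s x‖ ^ 2) := by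
    rw [← real_inner_self_eq_norm_sq]
    refine h1.congr_fun ?_
    intro i
    rw [h2, h3, sq]
  rw [← h4.tsum_eq, ENNReal.ofReal_tsum_of_nonneg (fun i => sq_nonneg _) h4.summable]
  have h5 := tsum_subtype {i : ι | i ∉ s} (fun i => ENNReal.ofReal (⟪b i, x⟫ ^ 2))
  change _ = ∑' i : {i : ι | i ∉ s}, ENNReal.ofReal (⟪b i, x⟫ ^ 2)
  rw [h5]
  refine tsum_congr fun i => ?_
  by_cases hi : i ∈ s <;> simp [Set.indicator, hi]

variable [MeasurableSpace H] [BorelSpace H]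

/-- For square summable weights `w` the random series `∑ w i * g i • b i` with independent
standard Gaussian `g i` has a Gaussian law, diagonal in the basis `b`. -/
theorem exists_gaussian_diagonal [CompleteSpace H] [Countable ι] (b : HilbertBasis ι ℝ H)
    {w : ι → ℝ} (hw : Summable fun i => w i ^ 2) :
    ∃ ν : ProbabilityMeasure H, IsGaussian (ν : Measure H) ∧
      ∀ y : H, charFun (ν : Measure H) y
        = Complex.exp ((-(∑' i, (w i * ⟪b i, y⟫) ^ 2) / 2 : ℝ) : ℂ) := by
  set G : Measure (ι → ℝ) := Measure.infinitePi fun _ : ι => gaussianReal 0 1 with hG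
  let Z : (ι → ℝ) → H := fun g => ∑' i, (w i * g i) • b i
  have hcoord : ∀ i, ∫⁻ g, ENNReal.ofReal ((w i * g i) ^ 2) ∂G = ENNReal.ofReal (w i ^ 2) := by
    intro i
    have h1 : ∫⁻ t, ENNReal.ofReal ((w i * t) ^ 2) ∂(gaussianReal 0 1)
        = ENNReal.ofReal (w i ^ 2) := by
      have hint : Integrable (fun t : ℝ => t ^ 2) (gaussianReal 0 1) :=
        (memLp_id_gaussianReal 2).integrable_sq
      have hvar : ∫ t, t ^ 2 ∂(gaussianReal 0 1) = 1 := by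
        have := variance_id_gaussianReal (μ := 0) (v := 1)
        rw [variance_eq_integral (by fun_prop)] at this
        simpa using this
      simp only [mul_pow]
      rw [← ofReal_integral_eq_lintegral_ofReal (hint.const_mul _)
        (Eventually.of_forall fun t => by positivity), integral_const_mul, hvar, mul_one]
    rw [← h1, ← (measurePreserving_eval_infinitePi (fun _ : ι => gaussianReal 0 1) i).map_eq,
      lintegral_map (by fun_prop) (measurable_pi_apply i)]
  have hfin : ∀ᵐ g ∂G, Summable fun i => (w i * g i) ^ 2 := by
    have h2 : ∫⁻ g, ∑' i, ENNReal.ofReal ((w i * g i) ^ 2) ∂G ≠ ⊤ := by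
      rw [lintegral_tsum (fun i => (by fun_prop : Measurable fun g : ι → ℝ =>
        ENNReal.ofReal ((w i * g i) ^ 2)).aemeasurable)]
      simp_rw [hcoord]
      rw [← ENNReal.ofReal_tsum_of_nonneg (fun i => sq_nonneg _) hw]
      exact ENNReal.ofReal_ne_top
    have hmeas : Measurable fun g : ι → ℝ => ∑' i, ENNReal.ofReal ((w i * g i) ^ 2) :=
      Measurable.tsum fun i => by fun_prop
    filter_upwards [ae_lt_top hmeas h2] with g hg
    have := ENNReal.summable_toReal hg.ne
    refine this.congr fun i => ENNReal.toReal_ofReal (sq_nonneg _)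
  -- the partial sums are continuous in `g` and converge almost surely, so `Z` is a.e. measurable
  have hsum : ∀ᵐ g ∂G, Tendsto (fun s : Finset ι => ∑ i ∈ s, (w i * g i) • b i) atTop
      (𝓝 (Z g)) := by
    filter_upwards [hfin] with g hg
    exact (summable_smul_of_summable_sq b hg).hasSum
  have hcont : ∀ s : Finset ι, Continuous fun g : ι → ℝ => ∑ i ∈ s, (w i * g i) • b i := by
    intro s; fun_prop
  have hZ : AEMeasurable Z G :=
    aemeasurable_of_tendsto_metrizable_ae atTop (fun s => (hcont s).measurable.aemeasurable) hsum
  have hchar : ∀ y : H, charFun (G.map Z) y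
      = Complex.exp ((-(∑' i, (w i * ⟪b i, y⟫) ^ 2) / 2 : ℝ) : ℂ) := by
    intro y
    rw [charFun_apply, integral_map hZ (by fun_prop)]
    have hlim1 : Tendsto (fun s : Finset ι =>
        ∫ g, Complex.exp (⟪∑ i ∈ s, (w i * g i) • b i, y⟫ * Complex.I) ∂G) atTop
        (𝓝 (∫ g, Complex.exp (⟪Z g, y⟫ * Complex.I) ∂G)) := by
      refine tendsto_integral_filter_of_dominated_convergence (fun _ => 1) ?_ ?_
        (integrable_const 1) ?_
      · refine Eventually.of_forall fun s => ?_
        have : Measurable fun g : ι → ℝ =>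
            Complex.exp (⟪∑ i ∈ s, (w i * g i) • b i, y⟫ * Complex.I) := by
          have := hcont s
          exact (by fun_prop : Continuous _).measurable
        exact this.aestronglyMeasurable
      · refine Eventually.of_forall fun s => Eventually.of_forall fun g => ?_
        rw [Complex.norm_exp_ofReal_mul_I]
      · filter_upwards [hsum] with g hg
        exact ((by fun_prop : Continuous fun x : H =>
          Complex.exp (⟪x, y⟫ * Complex.I)).tendsto _).comp hg
    have hsq : Summable fun i => (w i * ⟪b i, y⟫) ^ 2 := by
      refine (hw.mul_right (‖y‖ ^ 2)).of_nonneg_of_le (fun i => sq_nonneg _) fun i => ?_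
      rw [mul_pow]
      refine mul_le_mul_of_nonneg_left ?_ (sq_nonneg _)
      rw [sq_le_sq, abs_norm]
      refine (abs_real_inner_le_norm _ _).trans ?_
      rw [b.orthonormal.1 i, one_mul]
    have hlim2 : Tendsto (fun s : Finset ι =>
        Complex.exp ((-(∑ i ∈ s, (w i * ⟪b i, y⟫) ^ 2) / 2 : ℝ) : ℂ)) atTop
        (𝓝 (Complex.exp ((-(∑' i, (w i * ⟪b i, y⟫) ^ 2) / 2 : ℝ) : ℂ))) := by
      refine ((by fun_prop : Continuous fun t : ℝ => Complex.exp ((-t / 2 : ℝ) : ℂ)).tendsto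
        _).comp ?_
      exact hsq.hasSum
    refine tendsto_nhds_unique hlim1 ?_
    simp_rw [hG, charFun_finsetSum_gaussian b w y]
    exact hlim2
  have hprob : IsProbabilityMeasure (G.map Z) := Measure.isProbabilityMeasure_map hZ
  refine ⟨⟨G.map Z, hprob⟩, ?_, hchar⟩
  rw [ProbabilityMeasure.coe_mk]
  refine isGaussian_of_map_eq_gaussianReal fun L => ?_
  obtain ⟨y, rfl⟩ := (InnerProductSpace.toDual ℝ H).surjective L
  refine ⟨0, (∑' i, (w i * ⟪b i, y⟫) ^ 2).toNNReal, ?_⟩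
  have := Measure.isProbabilityMeasure_map (μ := G.map Z)
    ((InnerProductSpace.toDual ℝ H) y).continuous.aemeasurable
  refine Measure.ext_of_charFun ?_
  ext t
  have h1 : charFun ((G.map Z).map ((InnerProductSpace.toDual ℝ H) y)) t
      = charFun (G.map Z) (t • y) := by
    rw [charFun_apply, charFun_apply, integral_map (by fun_prop) (by fun_prop)]
    refine integral_congr_ae (Eventually.of_forall fun x => ?_)
    simp only [InnerProductSpace.toDual_apply_apply, real_inner_smul_right, real_inner_comm x y]
    simp [mul_comm]
  rw [h1, hchar, charFun_gaussianReal, Real.coe_toNNReal _ (tsum_nonneg fun i => sq_nonneg _)]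
  congr 1
  have : ∑' i, (w i * ⟪b i, t • y⟫) ^ 2 = t ^ 2 * ∑' i, (w i * ⟪b i, y⟫) ^ 2 := by
    rw [← tsum_mul_left]
    refine tsum_congr fun i => ?_
    rw [real_inner_smul_right]
    ring
  rw [this]
  push_cast
  ring

/-- Weak convergence of the truncations, by Lévy's continuity theorem in `EuclideanSpace ℝ s`. -/
theorem tendsto_integral_comp_truncation {κ : Type*} {l : Filter κ} [l.IsCountablyGenerated]
    (b : HilbertBasis ι ℝ H) {ν : κ → ProbabilityMeasure H} {ν₀ : ProbabilityMeasure H}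
    (hchar : ∀ (s : Finset ι) (a : ι → ℝ),
      Tendsto (fun n => charFun (ν n : Measure H) (∑ i ∈ s, a i • b i)) l
        (𝓝 (charFun (ν₀ : Measure H) (∑ i ∈ s, a i • b i))))
    (s : Finset ι) {F : H → ℝ} (hF : Continuous F) {C : ℝ} (hC : ∀ x y, dist (F x) (F y) ≤ C) :
    Tendsto (fun n => ∫ x, F (truncation b s x) ∂(ν n : Measure H)) l
      (𝓝 (∫ x, F (truncation b s x) ∂(ν₀ : Measure H))) := by
  classical
  let T : H → EuclideanSpace ℝ s := fun x => WithLp.toLp 2 fun i => ⟪b i, x⟫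
  let J : EuclideanSpace ℝ s → H := fun t => ∑ i : s, t i • b i
  have hT : Continuous T := by fun_prop
  have hJ : Continuous J := by fun_prop
  have hJT : ∀ x, J (T x) = truncation b s x := fun x =>
    Finset.sum_coe_sort s fun i => ⟪b i, x⟫ • b i
  have hinner : ∀ x t, ⟪T x, t⟫ = ⟪x, J t⟫ := by
    intro x t
    simp only [T, J, inner_sum, real_inner_smul_right, PiLp.inner_apply, RCLike.inner_apply,
      conj_trivial, real_inner_comm x]
  have hlevy : Tendsto (fun n => (ν n).map hT.aemeasurable) l (𝓝 (ν₀.map hT.aemeasurable)) := by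
    refine tendsto_of_seq_tendsto fun u hu => ?_
    refine ProbabilityMeasure.tendsto_of_tendsto_charFun fun t => ?_
    have h1 : ∀ m : ProbabilityMeasure H, charFun (m.map hT.aemeasurable : Measure _) t
        = charFun (m : Measure H) (∑ i ∈ s, (if h : i ∈ s then t ⟨i, h⟩ else 0) • b i) := by
      intro m
      rw [ProbabilityMeasure.toMeasure_map, charFun_apply, charFun_apply,
        integral_map hT.aemeasurable (by fun_prop)]
      simp only [hinner]
      congr! 6 with x
      change ∑ i : s, t i • b i = _
      rw [← Finset.sum_coe_sort s]
      exact Finset.sum_congr rfl fun i _ => by simp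
    simp only [Function.comp, h1]
    exact (hchar s _).comp hu
  have h2 := (ProbabilityMeasure.tendsto_iff_forall_integral_tendsto.1 hlevy)
    (BoundedContinuousFunction.mkOfBound ⟨F ∘ J, hF.comp hJ⟩ C fun x y => hC _ _)
  have h3 : ∀ m : ProbabilityMeasure H,
      ∫ x, (BoundedContinuousFunction.mkOfBound ⟨F ∘ J, hF.comp hJ⟩ C fun x y => hC _ _) x
        ∂(m.map hT.aemeasurable : Measure _) = ∫ x, F (truncation b s x) ∂(m : Measure H) := by
    intro m
    rw [ProbabilityMeasure.toMeasure_map, integral_map hT.aemeasurable (by fun_prop)]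
    simp only [← hJT]
    rfl
  simpa only [h3] using h2

/-- Convergence criterion on a Hilbert space: pointwise convergence of the characteristic functions
on finite combinations of basis vectors, with a uniform summable bound on the second moments of
the coordinates, implies weak convergence. -/
theorem tendsto_of_tendsto_charFun_of_moment_le {κ : Type*} {l : Filter κ}
    [l.IsCountablyGenerated]
    (b : HilbertBasis ι ℝ H) [Countable ι] {ν : κ → ProbabilityMeasure H}
    {ν₀ : ProbabilityMeasure H}
    (hchar : ∀ (s : Finset ι) (a : ι → ℝ),
      Tendsto (fun n => charFun (ν n : Measure H) (∑ i ∈ s, a i • b i)) l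
        (𝓝 (charFun (ν₀ : Measure H) (∑ i ∈ s, a i • b i))))
    {B : ι → ℝ} (hB : Summable B) (hB0 : ∀ i, 0 ≤ B i)
    (hmom : ∀ᶠ n in l, ∀ i, ∫⁻ x, ENNReal.ofReal (⟪b i, x⟫ ^ 2) ∂(ν n : Measure H)
      ≤ ENNReal.ofReal (B i)) :
    Tendsto ν l (𝓝 ν₀) := by
  rw [tendsto_iff_forall_lipschitz_integral_tendsto]
  rintro F ⟨C, hC⟩ ⟨L, hL⟩
  have hF := hL.continuous
  have hFint : ∀ (m : ProbabilityMeasure H) (g : H → H), Continuous g →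
      Integrable (fun x => F (g x)) (m : Measure H) := by
    intro m g hg
    refine Integrable.of_bound (hF.comp hg).aestronglyMeasurable (C + |F 0|)
      (Eventually.of_forall fun x => ?_)
    have := hC (g x) 0
    rw [Real.dist_eq] at this
    calc ‖F (g x)‖ = |(F (g x) - F 0) + F 0| := by simp
      _ ≤ |F (g x) - F 0| + |F 0| := abs_add_le _ _
      _ ≤ _ := by gcongr
  -- the truncation error in `L¹`, from `t ≤ δ + t² / δ`
  have herr : ∀ (s : Finset ι) (δ : ℝ), 0 < δ → ∀ᶠ n in l,
      |∫ x, F x ∂(ν n : Measure H) - ∫ x, F (truncation b s x) ∂(ν n : Measure H)|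
        ≤ L * (δ + (∑' i : {i // i ∉ s}, B i) / δ) := by
    intro s δ hδ
    filter_upwards [hmom] with n hn
    have hcont : Continuous fun x : H => ‖x - truncation b s x‖ ^ 2 := by
      have := continuous_truncation b s
      fun_prop
    have hBs : Summable fun i : {i // i ∉ s} => B i := hB.subtype _
    have hl : ∫⁻ x, ENNReal.ofReal (‖x - truncation b s x‖ ^ 2) ∂(ν n : Measure H)
        ≤ ENNReal.ofReal (∑' i : {i // i ∉ s}, B i) := by
      simp_rw [norm_sub_truncation_sq]
      rw [lintegral_tsum (fun i => by fun_prop),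
        ENNReal.ofReal_tsum_of_nonneg (fun i : {i // i ∉ s} => hB0 i) hBs]
      exact ENNReal.tsum_le_tsum fun i => hn i
    have hint : Integrable (fun x => ‖x - truncation b s x‖ ^ 2) (ν n : Measure H) := by
      refine ⟨hcont.aestronglyMeasurable, ?_⟩
      rw [hasFiniteIntegral_iff_ofReal (Eventually.of_forall fun x => by positivity)]
      exact hl.trans_lt ENNReal.ofReal_lt_top
    have hle : ∫ x, ‖x - truncation b s x‖ ^ 2 ∂(ν n : Measure H) ≤ ∑' i : {i // i ∉ s}, B i := by
      rw [integral_eq_lintegral_of_nonneg_ae (Eventually.of_forall fun x => by positivity)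
        hcont.aestronglyMeasurable]
      exact ENNReal.toReal_le_of_le_ofReal (tsum_nonneg fun i => hB0 i) hl
    have hF1 : Integrable F (ν n : Measure H) := hFint (ν n) id continuous_id
    rw [← integral_sub hF1 (hFint (ν n) _ (continuous_truncation b s))]
    refine (abs_integral_le_integral_abs).trans ?_
    calc ∫ x, |F x - F (truncation b s x)| ∂(ν n : Measure H)
        ≤ ∫ x, L * (δ + ‖x - truncation b s x‖ ^ 2 / δ) ∂(ν n : Measure H) := by
          refine integral_mono_of_nonneg (Eventually.of_forall fun x => abs_nonneg _) ?_
            (Eventually.of_forall fun x => ?_)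
          · exact ((integrable_const δ).add (hint.div_const δ)).const_mul _
          · have h1 := hL.dist_le_mul x (truncation b s x)
            rw [Real.dist_eq, dist_eq_norm] at h1
            refine h1.trans (mul_le_mul_of_nonneg_left ?_ L.2)
            have : 0 ≤ ‖x - truncation b s x‖ := norm_nonneg _
            rw [← sub_le_iff_le_add', le_div_iff₀ hδ]
            nlinarith [sq_nonneg (‖x - truncation b s x‖ - δ)]
      _ = L * (δ + (∫ x, ‖x - truncation b s x‖ ^ 2 ∂(ν n : Measure H)) / δ) := by
          rw [integral_const_mul, integral_add (integrable_const δ) (hint.div_const δ),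
            integral_div]
          simp
      _ ≤ _ := by gcongr
  have hlim : Tendsto (fun s => ∫ x, F (truncation b s x) ∂(ν₀ : Measure H)) atTop
      (𝓝 (∫ x, F x ∂(ν₀ : Measure H))) := by
    refine tendsto_integral_filter_of_dominated_convergence (fun _ => C + |F 0|) ?_ ?_
      (integrable_const _) ?_
    · exact Eventually.of_forall fun s => (hFint ν₀ _ (continuous_truncation b s)).1
    · refine Eventually.of_forall fun s => Eventually.of_forall fun x => ?_
      have := hC (truncation b s x) 0
      rw [Real.dist_eq] at this
      calc ‖F (truncation b s x)‖ = |(F (truncation b s x) - F 0) + F 0| := by simp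
        _ ≤ |F (truncation b s x) - F 0| + |F 0| := abs_add_le _ _
        _ ≤ _ := by gcongr
    · exact Eventually.of_forall fun x => (hF.tendsto _).comp (tendsto_truncation b x)
  have htail : Tendsto (fun s : Finset ι => ∑' i : {i // i ∉ s}, B i) atTop (𝓝 0) :=
    tendsto_tsum_compl_atTop_zero B
  rw [Metric.tendsto_nhds]
  intro η hη
  obtain ⟨δ, hδ, hδη⟩ : ∃ δ : ℝ, 0 < δ ∧ L * δ < η / 4 := by
    refine ⟨η / (4 * (L + 1)), by positivity, ?_⟩
    rw [mul_div_assoc', div_lt_div_iff₀ (by positivity) (by positivity)]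
    have : (0 : ℝ) ≤ L := L.2
    nlinarith
  have h1 : ∀ᶠ s in (atTop : Filter (Finset ι)),
      L * ((∑' i : {i // i ∉ s}, B i) / δ) < η / 4 := by
    have := (htail.div_const δ).const_mul (L : ℝ)
    simp only [zero_div, mul_zero] at this
    exact this.eventually (gt_mem_nhds (by positivity))
  have h2 : ∀ᶠ s in (atTop : Filter (Finset ι)),
      dist (∫ x, F (truncation b s x) ∂(ν₀ : Measure H)) (∫ x, F x ∂(ν₀ : Measure H)) < η / 4 :=
    (Metric.tendsto_nhds.1 hlim) _ (by positivity)
  obtain ⟨s, hs1, hs2⟩ := (h1.and h2).exists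
  filter_upwards [herr s δ hδ, (Metric.tendsto_nhds.1
    (tendsto_integral_comp_truncation b hchar s hF hC)) (η / 4) (by positivity)] with n hn1 hn2
  rw [Real.dist_eq] at *
  rw [mul_add] at hn1
  have e : ∫ x, F x ∂(ν n : Measure H) - ∫ x, F x ∂(ν₀ : Measure H)
    = (∫ x, F x ∂(ν n : Measure H) - ∫ x, F (truncation b s x) ∂(ν n : Measure H))
      + (∫ x, F (truncation b s x) ∂(ν n : Measure H)
        - ∫ x, F (truncation b s x) ∂(ν₀ : Measure H))
      + (∫ x, F (truncation b s x) ∂(ν₀ : Measure H) - ∫ x, F x ∂(ν₀ : Measure H)) := by ring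
  rw [e]
  refine (abs_add_three _ _ _).trans_lt ?_
  linarith

end Hilbert

/-! ### Summation over frequencies -/

section Frequencies

variable {d : ℕ}

theorem Freq.len_pos (ξ : Freq d) : 0 < ξ.len := zero_lt_one.trans_le ξ.one_le_len

theorem Freq.len_sq (ξ : Freq d) : ξ.len ^ 2 = ∑ i, (ξ.1 i : ℝ) ^ 2 :=
  Real.sq_sqrt (Finset.sum_nonneg fun _ _ => sq_nonneg _)

@[simp]
theorem Freq.opp_opp (ξ : Freq d) : ξ.opp.opp = ξ := Subtype.ext (neg_neg _)

@[simp]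
theorem Freq.len_opp (ξ : Freq d) : ξ.opp.len = ξ.len := by
  simp [Freq.len, Freq.opp]

/-- The involution `ξ ↦ -ξ`. -/
def Freq.oppEquiv (d : ℕ) : Freq d ≃ Freq d where
  toFun := Freq.opp
  invFun := Freq.opp
  left_inv := Freq.opp_opp
  right_inv := Freq.opp_opp

theorem Freq.summable_comp_opp {f : Freq d → ℝ} (hf : Summable f) :
    Summable fun ξ : Freq d => f ξ.opp :=
  (Freq.oppEquiv d).summable_iff.2 hf

theorem Freq.tsum_comp_opp (f : Freq d → ℝ) : ∑' ξ : Freq d, f ξ.opp = ∑' ξ, f ξ :=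
  (Freq.oppEquiv d).tsum_eq f

/-- Comparison with the sum over the lattice `ℤᵈ` in the sup norm. -/
theorem Freq.summable_len_rpow {p : ℝ} (hp : p < -(d : ℝ)) :
    Summable fun ξ : Freq d => ξ.len ^ p := by
  let L : Submodule ℤ (Fin d → ℝ) := Submodule.span ℤ (Set.range (Pi.basisFun ℝ (Fin d)))
  have hrank : Module.finrank ℤ L = d := by
    have := ZLattice.rank ℝ L
    simpa using this
  have hmem : ∀ ξ : Freq d, (fun i => (ξ.1 i : ℝ)) ∈ L := by
    intro ξ
    rw [Module.Basis.mem_span_iff_repr_mem]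
    intro i
    exact ⟨ξ.1 i, by simp⟩
  have hs := ZLattice.summable_norm_rpow L p (by rw [hrank]; exact hp)
  have hinj : Function.Injective fun ξ : Freq d => (⟨fun i => (ξ.1 i : ℝ), hmem ξ⟩ : L) := by
    intro ξ η h
    apply Subtype.ext
    funext i
    exact Int.cast_injective (congrFun (congrArg Subtype.val h) i)
  refine (hs.comp_injective hinj).of_nonneg_of_le (fun ξ => (Real.rpow_pos_of_pos ξ.len_pos _).le)
    fun ξ => ?_
  have hpos : 0 < ‖fun i => (ξ.1 i : ℝ)‖ := by
    rw [norm_pos_iff]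
    intro h
    apply ξ.2
    funext i
    exact Int.cast_eq_zero.1 (congrFun h i)
  have hle : ‖fun i => (ξ.1 i : ℝ)‖ ≤ ξ.len := by
    refine (pi_norm_le_iff_of_nonneg ξ.len_pos.le).2 fun i => ?_
    refine Real.le_sqrt_of_sq_le ?_
    rw [Real.norm_eq_abs, sq_abs]
    exact Finset.single_le_sum (f := fun i => (ξ.1 i : ℝ) ^ 2) (fun _ _ => sq_nonneg _)
      (Finset.mem_univ i)
  exact Real.rpow_le_rpow_of_nonpos hpos hle (hp.le.trans (by simp))

theorem Freq.summable_len_rpow_neg_four_mul {ε : ℝ≥0} (hε : (d : ℝ) / 4 < ε) :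
    Summable fun ξ : Freq d => ξ.len ^ (-4 * (ε : ℝ)) :=
  Freq.summable_len_rpow (by linarith)

end Frequencies

/-! ### Fourier coefficients of smooth functions -/

section Smooth

variable {d : ℕ}

/-- The projection of `ℝᵈ` onto the torus. -/
def toTorus (x : Fin d → ℝ) : Torus d := fun i => (x i : UnitAddCircle)

theorem isOpenQuotientMap_toTorus : IsOpenQuotientMap (toTorus (d := d)) :=
  IsOpenQuotientMap.piMap fun _ => QuotientAddGroup.isOpenQuotientMap_mk

theorem continuous_of_comp_toTorus {f : Torus d → ℝ} (hf : Continuous fun x => f (toTorus x)) :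
    Continuous f :=
  isOpenQuotientMap_toTorus.continuous_comp_iff.1 hf

theorem exists_norm_le_of_continuous {f : Torus d → ℝ} (hf : Continuous f) :
    ∃ C : ℝ, ∀ z, ‖f z‖ ≤ C := by
  obtain ⟨C, hC⟩ := isCompact_univ.exists_bound_of_continuousOn (f := f) hf.continuousOn
  exact ⟨C, fun z => hC z (Set.mem_univ z)⟩

theorem memLp_of_continuous {f : Torus d → ℝ} (hf : Continuous f) : MemLp f 2 (torusMeasure d) := by
  obtain ⟨C, hC⟩ := exists_norm_le_of_continuous hf
  exact MemLp.of_bound hf.aestronglyMeasurable C (Eventually.of_forall hC)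

/-- The translate of `z` by `t` in the `i`-th coordinate direction. -/
def shift (i : Fin d) (t : ℝ) (z : Torus d) : Torus d := z + Pi.single i (t : UnitAddCircle)

theorem shift_toTorus (i : Fin d) (t : ℝ) (x : Fin d → ℝ) :
    shift i t (toTorus x) = toTorus (x + t • Pi.single i 1) := by
  funext j
  by_cases h : j = i
  · subst h
    simp [shift, toTorus]
  · simp [shift, toTorus, h]

/-- The `i`-th partial derivative of a function on the torus. -/
def partialDeriv (i : Fin d) (f : Torus d → ℝ) (z : Torus d) : ℝ :=
  deriv (fun t => f (shift i t z)) 0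

/-- Smoothness of a function on the torus, in terms of its periodic lift. -/
def IsSmooth (f : Torus d → ℝ) : Prop := ContDiff ℝ (⊤ : ℕ∞) fun x => f (toTorus x)

theorem IsSmooth.continuous {f : Torus d → ℝ} (hf : IsSmooth f) : Continuous f :=
  continuous_of_comp_toTorus (ContDiff.continuous hf)

theorem IsSmooth.hasDerivAt_shift {f : Torus d → ℝ} (hf : IsSmooth f) (i : Fin d)
    (x : Fin d → ℝ) (t : ℝ) :
    HasDerivAt (fun t => f (shift i t (toTorus x)))
      (fderiv ℝ (fun x => f (toTorus x)) (x + t • Pi.single i 1) (Pi.single i 1)) t := by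
  simp only [shift_toTorus]
  have h1 : HasFDerivAt (fun x => f (toTorus x))
      (fderiv ℝ (fun x => f (toTorus x)) (x + t • Pi.single i 1)) (x + t • Pi.single i 1) :=
    ((ContDiff.differentiable hf (by simp)) _).hasFDerivAt
  have h2 : HasDerivAt (fun t : ℝ => x + t • (Pi.single i 1 : Fin d → ℝ)) (Pi.single i 1) t := by
    simpa using ((hasDerivAt_id t).smul_const (Pi.single i 1 : Fin d → ℝ)).const_add x
  exact h1.comp_hasDerivAt t h2

theorem IsSmooth.partialDeriv_toTorus {f : Torus d → ℝ} (hf : IsSmooth f) (i : Fin d)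
    (x : Fin d → ℝ) :
    partialDeriv i f (toTorus x) = fderiv ℝ (fun x => f (toTorus x)) x (Pi.single i 1) := by
  have := (hf.hasDerivAt_shift i x 0).deriv
  simpa [partialDeriv] using this

theorem IsSmooth.partialDeriv {f : Torus d → ℝ} (hf : IsSmooth f) (i : Fin d) :
    IsSmooth (partialDeriv i f) := by
  unfold IsSmooth
  simp only [hf.partialDeriv_toTorus]
  exact (ContDiff.fderiv_right hf (m := (⊤ : ℕ∞)) (by simp)).clm_apply contDiff_const

theorem IsSmooth.hasDerivAt {f : Torus d → ℝ} (hf : IsSmooth f) (i : Fin d) (z : Torus d) (t : ℝ) :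
    HasDerivAt (fun t => f (shift i t z)) (Sandpile.partialDeriv i f (shift i t z)) t := by
  obtain ⟨x, rfl⟩ := isOpenQuotientMap_toTorus.surjective z
  have := hf.hasDerivAt_shift i x t
  rwa [← hf.partialDeriv_toTorus, ← shift_toTorus] at this

theorem mFourier_add_apply (ξ : Fin d → ℤ) (z w : Torus d) :
    UnitAddTorus.mFourier ξ (z + w) = UnitAddTorus.mFourier ξ z * UnitAddTorus.mFourier ξ w := by
  simp only [UnitAddTorus.mFourier, ContinuousMap.coe_mk, ← Finset.prod_mul_distrib]
  refine Finset.prod_congr rfl fun i _ => ?_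
  simp only [fourier_apply, Pi.add_apply, smul_add, AddCircle.toCircle_add, Circle.coe_mul]

theorem mFourier_single_apply (ξ : Fin d → ℤ) (i : Fin d) (t : ℝ) :
    UnitAddTorus.mFourier ξ (Pi.single i (t : UnitAddCircle))
      = Complex.exp (2 * Real.pi * Complex.I * ξ i * t) := by
  simp only [UnitAddTorus.mFourier, ContinuousMap.coe_mk]
  rw [Finset.prod_eq_single i]
  · rw [Pi.single_eq_same, fourier_coe_apply]
    simp
  · intro j _ hj
    rw [Pi.single_eq_of_ne hj]
    simp
  · simp

instance isAddLeftInvariant_torusMeasure : (torusMeasure d).IsAddLeftInvariant := by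
  unfold torusMeasure; infer_instance

/-- Fourier coefficients of a partial derivative, by differentiating the Fourier coefficient of the
translates of `f` in two ways. -/
theorem IsSmooth.fourierCoef_partialDeriv {f : Torus d → ℝ} (hf : IsSmooth f) (i : Fin d)
    (ξ : Fin d → ℤ) :
    fourierCoef (Sandpile.partialDeriv i f) ξ
      = 2 * Real.pi * Complex.I * ξ i * fourierCoef f ξ := by
  obtain ⟨C, hC⟩ := exists_norm_le_of_continuous (hf.partialDeriv i).continuous
  have hcs : ∀ t, Continuous (shift (d := d) i t) := fun t => by unfold shift; fun_prop
  have hcont : ∀ (t : ℝ) {g : Torus d → ℝ}, Continuous g →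
      Continuous fun z => UnitAddTorus.mFourier (-ξ) z * (g (shift i t z) : ℂ) := fun t g hg =>
    (UnitAddTorus.mFourier (-ξ)).continuous.mul
      (Complex.continuous_ofReal.comp (hg.comp (hcs t)))
  have hbd : ∀ z : Torus d, ‖UnitAddTorus.mFourier (-ξ) z‖ ≤ 1 := fun z =>
    ((UnitAddTorus.mFourier (-ξ)).norm_coe_le_norm z).trans UnitAddTorus.mFourier_norm.le
  obtain ⟨C', hC'⟩ := exists_norm_le_of_continuous hf.continuous
  have hint : ∀ (t : ℝ) {g : Torus d → ℝ}, Continuous g → ∀ M : ℝ, (∀ z, ‖g z‖ ≤ M) →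
      Integrable (fun z => UnitAddTorus.mFourier (-ξ) z * (g (shift i t z) : ℂ))
        (torusMeasure d) := by
    intro t g hg M hM
    refine Integrable.of_bound (hcont t hg).aestronglyMeasurable M
      (Eventually.of_forall fun z => ?_)
    rw [norm_mul, Complex.norm_real]
    calc _ ≤ 1 * M := mul_le_mul (hbd z) (hM _) (norm_nonneg _) zero_le_one
      _ = M := one_mul M
  have h1 := (hasDerivAt_integral_of_dominated_loc_of_deriv_le (μ := torusMeasure d) (x₀ := (0 : ℝ))
    (F := fun (t : ℝ) z => UnitAddTorus.mFourier (-ξ) z * (f (shift i t z) : ℂ))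
    (F' := fun (t : ℝ) z =>
      UnitAddTorus.mFourier (-ξ) z * (Sandpile.partialDeriv i f (shift i t z) : ℂ))
    (s := Set.univ) (bound := fun _ => C) Filter.univ_mem
    (Eventually.of_forall fun t => (hcont t hf.continuous).aestronglyMeasurable)
    (hint 0 hf.continuous C' hC')
    (hcont 0 (hf.partialDeriv i).continuous).aestronglyMeasurable
    (Eventually.of_forall fun z t _ => by
      rw [norm_mul, Complex.norm_real]
      calc _ ≤ 1 * C := mul_le_mul (hbd z) (hC _) (norm_nonneg _) zero_le_one
        _ = C := one_mul C)
    (integrable_const C)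
    (Eventually.of_forall fun z t _ => ((hf.hasDerivAt i z t).ofReal_comp).const_mul _)).2
  have h2 : (fun t : ℝ => ∫ z, UnitAddTorus.mFourier (-ξ) z * (f (shift i t z) : ℂ)
        ∂(torusMeasure d))
      = fun t : ℝ => Complex.exp ((2 * Real.pi * Complex.I * ξ i) * t) * fourierCoef f ξ := by
    funext t
    rw [fourierCoef, ← integral_const_mul, ← integral_add_right_eq_self
      (fun z => Complex.exp ((2 * Real.pi * Complex.I * ξ i) * t)
        * (UnitAddTorus.mFourier (-ξ) z * (f z : ℂ))) (Pi.single i (t : UnitAddCircle) : Torus d)]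
    refine integral_congr_ae (Eventually.of_forall fun z => ?_)
    simp only [mFourier_add_apply, mFourier_single_apply, shift, Pi.neg_apply]
    rw [mul_comm (UnitAddTorus.mFourier (-ξ) z) (Complex.exp _), ← mul_assoc, ← mul_assoc,
      ← Complex.exp_add]
    simp
  rw [h2] at h1
  have h3 : HasDerivAt (fun t : ℝ => Complex.exp ((2 * Real.pi * Complex.I * ξ i) * t)
      * fourierCoef f ξ) (2 * Real.pi * Complex.I * ξ i * fourierCoef f ξ) 0 := by
    have h4 : HasDerivAt (fun t : ℝ => (2 * Real.pi * Complex.I * ξ i) * (t : ℂ))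
        (2 * Real.pi * Complex.I * ξ i) 0 := by
      simpa using (Complex.ofRealCLM.hasDerivAt (x := (0 : ℝ))).const_mul
        (2 * Real.pi * Complex.I * ξ i : ℂ)
    simpa using h4.cexp.mul_const (fourierCoef f ξ)
  have h4 := h1.unique h3
  rw [← h4, fourierCoef]
  simp [shift]

theorem norm_fourierCoef_le {f : Torus d → ℝ} {C : ℝ} (hC : ∀ z, ‖f z‖ ≤ C) (ξ : Fin d → ℤ) :
    ‖fourierCoef f ξ‖ ≤ C := by
  have := norm_integral_le_of_norm_le_const (μ := torusMeasure d)
    (f := fun z => UnitAddTorus.mFourier (-ξ) z * (f z : ℂ)) (C := C)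
    (Eventually.of_forall fun z => by
      rw [norm_mul, Complex.norm_real]
      have h := ((UnitAddTorus.mFourier (-ξ)).norm_coe_le_norm z).trans
        UnitAddTorus.mFourier_norm.le
      calc _ ≤ 1 * C := mul_le_mul h (hC _) (norm_nonneg _) zero_le_one
        _ = C := one_mul C)
  simpa [fourierCoef] using this

theorem IsSmooth.exists_coord_pow_mul_le {f : Torus d → ℝ} (hf : IsSmooth f) (i : Fin d) (m : ℕ) :
    ∃ C, ∀ ξ : Fin d → ℤ, |(ξ i : ℝ)| ^ m * ‖fourierCoef f ξ‖ ≤ C := by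
  induction m generalizing f with
  | zero =>
    obtain ⟨C, hC⟩ := exists_norm_le_of_continuous hf.continuous
    exact ⟨C, fun ξ => by simpa using norm_fourierCoef_le hC ξ⟩
  | succ m ih =>
    obtain ⟨C, hC⟩ := ih (hf.partialDeriv i)
    refine ⟨C, fun ξ => le_trans ?_ (hC ξ)⟩
    rw [hf.fourierCoef_partialDeriv, pow_succ, mul_assoc]
    refine mul_le_mul_of_nonneg_left ?_ (by positivity)
    rw [norm_mul]
    refine mul_le_mul_of_nonneg_right ?_ (norm_nonneg _)
    have : ‖(2 * Real.pi * Complex.I * ξ i : ℂ)‖ = 2 * Real.pi * |(ξ i : ℝ)| := by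
      simp [abs_of_pos Real.pi_pos]
    rw [this]
    have := Real.pi_gt_three
    nlinarith [abs_nonneg (ξ i : ℝ)]

/-- The Fourier coefficients of a smooth function decay faster than every power. -/
theorem IsSmooth.exists_len_pow_mul_le {f : Torus d → ℝ} (hf : IsSmooth f) (k : ℕ) :
    ∃ C, 0 ≤ C ∧ ∀ ξ : Freq d, ξ.len ^ (2 * (k + 1)) * ‖fourierCoef f ξ.1‖ ≤ C := by
  choose C hC using fun i => hf.exists_coord_pow_mul_le i (2 * (k + 1))
  have hC0 : ∀ i, 0 ≤ C i := fun i => le_trans (by positivity) (hC i 0)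
  refine ⟨(d : ℝ) ^ k * ∑ i, C i,
    mul_nonneg (by positivity) (Finset.sum_nonneg fun i _ => hC0 i), fun ξ => ?_⟩
  have h1 := pow_sum_div_card_le_sum_pow (s := Finset.univ) (f := fun i => (ξ.1 i : ℝ) ^ 2)
    (fun i _ => sq_nonneg _) k
  have hd : (0 : ℝ) < d := by
    obtain ⟨i, _⟩ := Function.ne_iff.1 ξ.2
    exact_mod_cast i.pos
  rw [Finset.card_univ, Fintype.card_fin, div_le_iff₀ (by positivity)] at h1
  rw [pow_mul, ξ.len_sq]
  calc (∑ i, (ξ.1 i : ℝ) ^ 2) ^ (k + 1) * ‖fourierCoef f ξ.1‖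
      ≤ ((∑ i, ((ξ.1 i : ℝ) ^ 2) ^ (k + 1)) * (d : ℝ) ^ k) * ‖fourierCoef f ξ.1‖ := by gcongr
    _ = (d : ℝ) ^ k * ∑ i, |(ξ.1 i : ℝ)| ^ (2 * (k + 1)) * ‖fourierCoef f ξ.1‖ := by
        rw [← Finset.sum_mul]
        simp only [pow_mul, sq_abs]
        ring
    _ ≤ _ := by
        gcongr with i
        exact hC i ξ.1

theorem IsSmooth.summable_len_rpow_mul_sq {f : Torus d → ℝ} (hf : IsSmooth f) (p : ℝ) :
    Summable fun ξ : Freq d => ξ.len ^ p * ‖fourierCoef f ξ.1‖ ^ 2 := by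
  obtain ⟨k, hk⟩ := exists_nat_gt (p + d)
  obtain ⟨C, hC0, hC⟩ := hf.exists_len_pow_mul_le k
  have hs : Summable fun ξ : Freq d => ξ.len ^ (p - (4 * (k + 1) : ℕ)) * C ^ 2 := by
    refine (Freq.summable_len_rpow ?_).mul_right _
    have : (0 : ℝ) ≤ k := Nat.cast_nonneg k
    push_cast
    linarith
  refine hs.of_nonneg_of_le (fun ξ => ?_) fun ξ => ?_
  · have := Real.rpow_pos_of_pos ξ.len_pos p
    positivity
  · rw [Real.rpow_sub ξ.len_pos, Real.rpow_natCast, div_mul_eq_mul_div, le_div_iff₀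
      (pow_pos ξ.len_pos _), mul_assoc]
    refine mul_le_mul_of_nonneg_left ?_ (Real.rpow_pos_of_pos ξ.len_pos p).le
    have := pow_le_pow_left₀ (mul_nonneg (pow_pos ξ.len_pos _).le (norm_nonneg _)) (hC ξ) 2
    refine le_trans (le_of_eq ?_) this
    ring

end Smooth

/-! ### Hartley coordinates on the Sobolev space and the limiting field -/

section Hartley

open scoped RealInnerProductSpace

variable {d : ℕ}

/-- The real Hilbert space of square summable real families indexed by the nonzero frequencies. -/
abbrev RealEllTwo (d : ℕ) : Type := lp (fun _ : Freq d => ℝ) 2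

instance : MeasurableSpace (RealEllTwo d) := borel _

instance : BorelSpace (RealEllTwo d) := ⟨rfl⟩

/-- The coordinate basis of `RealEllTwo d`. -/
def coordBasis (d : ℕ) : HilbertBasis (Freq d) ℝ (RealEllTwo d) :=
  HilbertBasis.ofRepr (LinearIsometryEquiv.refl ℝ _)

theorem inner_coordBasis (ξ : Freq d) (y : RealEllTwo d) : ⟪coordBasis d ξ, y⟫ = y ξ := by
  rw [← HilbertBasis.repr_apply_apply]
  rfl

theorem summable_sq_coord (y : RealEllTwo d) : Summable fun ξ => y ξ ^ 2 := by
  have := (memℓp_gen_iff (p := 2) (by norm_num)).1 y.2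
  simpa using this

theorem memℓp_two_of_summable_sq {c : Freq d → ℝ} (hc : Summable fun ξ => c ξ ^ 2) :
    Memℓp c 2 := by
  rw [memℓp_gen_iff (by norm_num)]
  simpa using hc

/-- The complex family with the Hermitian symmetry `z(-ξ) = conj z(ξ)` such that
`Re z + Im z = y`: the passage from the Hartley to the Fourier coefficients of a real object. -/
def hermitian (y : Freq d → ℝ) (ξ : Freq d) : ℂ :=
  ⟨(y ξ + y ξ.opp) / 2, (y ξ - y ξ.opp) / 2⟩

theorem hermitian_opp (y : Freq d → ℝ) (ξ : Freq d) :
    hermitian y ξ.opp = conj (hermitian y ξ) := by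
  apply Complex.ext
  · simp [hermitian, add_comm]
  · simp [hermitian]
    ring

theorem norm_hermitian_sq (y : Freq d → ℝ) (ξ : Freq d) :
    ‖hermitian y ξ‖ ^ 2 = (y ξ ^ 2 + y ξ.opp ^ 2) / 2 := by
  rw [Complex.sq_norm, Complex.normSq_apply, hermitian]
  ring

/-- A Hermitian family is determined by its Hartley coefficients `Re z + Im z`. -/
theorem hermitian_re_add_im {z : Freq d → ℂ} (hz : ∀ ξ, z ξ.opp = conj (z ξ)) (ξ : Freq d) :
    hermitian (fun ξ => (z ξ).re + (z ξ).im) ξ = z ξ := by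
  apply Complex.ext
  · simp only [hermitian, hz, Complex.conj_re, Complex.conj_im]
    ring
  · simp only [hermitian, hz, Complex.conj_re, Complex.conj_im]
    ring

theorem hermitian_add (y y' : Freq d → ℝ) (ξ : Freq d) :
    hermitian (fun ξ => y ξ + y' ξ) ξ = hermitian y ξ + hermitian y' ξ := by
  apply Complex.ext <;> simp only [hermitian, Complex.add_re, Complex.add_im] <;> ring

theorem hermitian_smul (r : ℝ) (y : Freq d → ℝ) (ξ : Freq d) :
    hermitian (fun ξ => r * y ξ) ξ = r • hermitian y ξ := by
  apply Complex.ext <;> simp only [hermitian, Complex.smul_re, Complex.smul_im, smul_eq_mul] <;>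
    ring

theorem len_rpow_mul_norm_hermitian_sq (ε : ℝ≥0) (y : Freq d → ℝ) (ξ : Freq d) :
    ξ.len ^ (-4 * (ε : ℝ)) * ‖((ξ.len ^ (2 * (ε : ℝ)) : ℝ) : ℂ) * hermitian y ξ‖ ^ 2
      = (y ξ ^ 2 + y ξ.opp ^ 2) / 2 := by
  have h0 := ξ.len_pos
  rw [norm_mul, mul_pow, norm_hermitian_sq, Complex.norm_real, Real.norm_eq_abs, sq_abs,
    ← Real.rpow_natCast, ← Real.rpow_mul h0.le, ← mul_assoc, ← Real.rpow_add h0]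
  rw [show -4 * (ε : ℝ) + 2 * (ε : ℝ) * ((2 : ℕ) : ℝ) = 0 by push_cast; ring, Real.rpow_zero,
    one_mul]

/-- The element of `H^{-ε}` with Fourier coefficients `‖ξ‖^(2ε) z(ξ)`, where `z` is the Hermitian
family with Hartley coefficients `y`. -/
def ofHartleyₗ (d : ℕ) (ε : ℝ≥0) : RealEllTwo d →ₗ[ℝ] NegSobolev d ε where
  toFun y := ⟨fun ξ => ((ξ.len ^ (2 * (ε : ℝ)) : ℝ) : ℂ) * hermitian (fun ξ => y ξ) ξ, by
    constructor
    · intro ξ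
      beta_reduce
      rw [hermitian_opp, Freq.len_opp, map_mul, Complex.conj_ofReal]
    · simp_rw [len_rpow_mul_norm_hermitian_sq]
      exact ((summable_sq_coord y).add (Freq.summable_comp_opp (summable_sq_coord y))).div_const 2⟩
  map_add' a b := by
    apply Subtype.ext
    funext ξ
    exact (congrArg _ (hermitian_add _ _ ξ)).trans (mul_add _ _ _)
  map_smul' r a := by
    apply Subtype.ext
    funext ξ
    exact (congrArg _ (hermitian_smul r _ ξ)).trans (mul_smul_comm r _ _)

theorem coeff_ofHartleyₗ (ε : ℝ≥0) (y : RealEllTwo d) (ξ : Freq d) :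
    (ofHartleyₗ d ε y).coeff ξ
      = ((ξ.len ^ (2 * (ε : ℝ)) : ℝ) : ℂ) * hermitian (fun ξ => y ξ) ξ := rfl

theorem norm_ofHartleyₗ (ε : ℝ≥0) (y : RealEllTwo d) : ‖ofHartleyₗ d ε y‖ = ‖y‖ := by
  refine (sq_eq_sq₀ (norm_nonneg _) (norm_nonneg _)).1 ?_
  have h2 := lp.norm_rpow_eq_tsum (p := 2) (by norm_num) y
  simp only [ENNReal.toReal_ofNat, Real.rpow_ofNat, Real.norm_eq_abs, sq_abs] at h2
  rw [NegSobolev.norm_sq, h2]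
  simp_rw [coeff_ofHartleyₗ, len_rpow_mul_norm_hermitian_sq]
  rw [tsum_div_const, (summable_sq_coord y).tsum_add
    (Freq.summable_comp_opp (summable_sq_coord y)), Freq.tsum_comp_opp (fun ξ => y ξ ^ 2)]
  ring

/-- The linear isometry `ofHartleyₗ` as a continuous linear map. -/
def ofHartley (d : ℕ) (ε : ℝ≥0) : RealEllTwo d →L[ℝ] NegSobolev d ε :=
  (⟨ofHartleyₗ d ε, norm_ofHartleyₗ ε⟩ : RealEllTwo d →ₗᵢ[ℝ] NegSobolev d ε).toContinuousLinearMap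

theorem coeff_ofHartley (ε : ℝ≥0) (y : RealEllTwo d) (ξ : Freq d) :
    (ofHartley d ε y).coeff ξ
      = ((ξ.len ^ (2 * (ε : ℝ)) : ℝ) : ℂ) * hermitian (fun ξ => y ξ) ξ := rfl

theorem NegSobolev.ext {ε : ℝ≥0} {a b : NegSobolev d ε} (h : ∀ ξ, a.coeff ξ = b.coeff ξ) : a = b :=
  Subtype.ext (funext h)

/-- The pairing with `ofHartley y` is the inner product of `y` with the weighted Hartley
coefficients of the test function. -/
theorem exists_pairing_ofHartley {f : Torus d → ℝ} (hf : IsTest f) (ε : ℝ≥0) :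
    ∃ W : RealEllTwo d,
      (∀ ξ, W ξ = ξ.len ^ (2 * (ε : ℝ)) * ((fourierCoef f ξ.1).re + (fourierCoef f ξ.1).im)) ∧
      ∀ y, pairing (ofHartley d ε y) f = ⟪y, W⟫ := by
  have hsm : IsSmooth f := hf.smooth
  have hopp : ∀ ξ : Freq d, fourierCoef f ξ.opp.1 = conj (fourierCoef f ξ.1) :=
    (fourierCoef_mem ε (memLp_of_continuous hsm.continuous)).1
  have hs : Summable fun ξ : Freq d => (ξ.len ^ (2 * (ε : ℝ))
      * ((fourierCoef f ξ.1).re + (fourierCoef f ξ.1).im)) ^ 2 := by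
    refine ((hsm.summable_len_rpow_mul_sq (4 * (ε : ℝ))).mul_left 2).of_nonneg_of_le
      (fun ξ => sq_nonneg _) fun ξ => ?_
    rw [mul_pow, ← Real.rpow_natCast, ← Real.rpow_mul ξ.len_pos.le, mul_left_comm,
      show 2 * (ε : ℝ) * ((2 : ℕ) : ℝ) = 4 * ε by push_cast; ring]
    refine mul_le_mul_of_nonneg_left ?_ (Real.rpow_pos_of_pos ξ.len_pos _).le
    rw [Complex.sq_norm, Complex.normSq_apply]
    nlinarith [sq_nonneg ((fourierCoef f ξ.1).re - (fourierCoef f ξ.1).im)]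
  let W : RealEllTwo d := ⟨_, memℓp_two_of_summable_sq hs⟩
  have hW : ∀ ξ, W ξ = ξ.len ^ (2 * (ε : ℝ))
      * ((fourierCoef f ξ.1).re + (fourierCoef f ξ.1).im) := fun ξ => rfl
  refine ⟨W, hW, fun y => ?_⟩
  have hyW : Summable fun ξ => y ξ * W ξ := by
    refine (lp.summable_inner (𝕜 := ℝ) y W).congr fun ξ => ?_
    simp [mul_comm]
  -- symmetrizing the sum over `ξ ↦ -ξ` turns the inner product into the pairing
  have h1 : ∀ ξ : Freq d, ((ofHartley d ε y).coeff ξ * conj (fourierCoef f ξ.1)).re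
      = (y ξ * W ξ + y ξ.opp * W ξ.opp) / 2 := by
    intro ξ
    rw [hW, hW, hopp, Freq.len_opp, coeff_ofHartley, mul_assoc, Complex.re_ofReal_mul]
    simp only [hermitian, Complex.mul_re, Complex.conj_re, Complex.conj_im]
    ring
  rw [pairing, tsum_congr h1, tsum_div_const,
    hyW.tsum_add (Freq.summable_comp_opp (f := fun ξ => y ξ * W ξ) hyW),
    Freq.tsum_comp_opp (fun ξ => y ξ * W ξ), lp.inner_eq_tsum]
  have : ∀ ξ, ⟪y ξ, W ξ⟫ = y ξ * W ξ := fun ξ => by simp [mul_comm]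
  simp_rw [this]
  ring

/-- The Gaussian law on `RealEllTwo d` with independent coordinates of variances
`‖ξ‖^(-4-4ε)` is mapped by `ofHartley` to the law of the bi-Laplacian field. -/
theorem exists_hartley_FGF2 {ε : ℝ≥0} (hε : (d : ℝ) / 4 < ε) :
    ∃ ν : ProbabilityMeasure (RealEllTwo d),
      (∀ y : RealEllTwo d, charFun (ν : Measure (RealEllTwo d)) y
        = Complex.exp ((-(∑' ξ : Freq d, (ξ.len ^ (-2 - 2 * (ε : ℝ)) * y ξ) ^ 2) / 2 : ℝ) : ℂ)) ∧
      IsFGF2 ((ν : Measure (RealEllTwo d)).map (ofHartley d ε)) := by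
  have hw : Summable fun ξ : Freq d => (ξ.len ^ (-2 - 2 * (ε : ℝ))) ^ 2 := by
    refine (Freq.summable_len_rpow_neg_four_mul hε).of_nonneg_of_le (fun ξ => sq_nonneg _)
      fun ξ => ?_
    rw [← Real.rpow_natCast, ← Real.rpow_mul ξ.len_pos.le]
    refine Real.rpow_le_rpow_of_exponent_le ξ.one_le_len ?_
    push_cast
    linarith
  obtain ⟨ν, hν, hchar⟩ := exists_gaussian_diagonal (coordBasis d) hw
  simp_rw [inner_coordBasis] at hchar
  refine ⟨ν, hchar, ?_, ?_⟩
  · infer_instance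
  · intro f hf
    obtain ⟨W, hW, hpair⟩ := exists_pairing_ofHartley hf ε
    have hsm : IsSmooth f := hf.smooth
    have hopp : ∀ ξ : Freq d, fourierCoef f ξ.opp.1 = conj (fourierCoef f ξ.1) :=
      (fourierCoef_mem ε (memLp_of_continuous hsm.continuous)).1
    have hpm : IsClosedEmbedding (ofHartley d ε) :=
      (LinearIsometry.isometry (⟨ofHartleyₗ d ε, norm_ofHartleyₗ ε⟩ :
        RealEllTwo d →ₗᵢ[ℝ] NegSobolev d ε)).isClosedEmbedding
    rw [hpm.measurableEmbedding.integral_map]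
    have h1 : ∫ y, Complex.exp (Complex.I * (pairing (ofHartley d ε y) f : ℂ))
        ∂(ν : Measure (RealEllTwo d)) = charFun (ν : Measure (RealEllTwo d)) W := by
      rw [charFun_apply]
      refine integral_congr_ae (Eventually.of_forall fun y => ?_)
      simp only [hpair, mul_comm]
    rw [h1, hchar]
    refine congrArg (fun t : ℝ => Complex.exp t) ?_
    have h2 : ∀ ξ : Freq d, (ξ.len ^ (-2 - 2 * (ε : ℝ)) * W ξ) ^ 2
        = ξ.len ^ (-4 : ℝ) * ((fourierCoef f ξ.1).re + (fourierCoef f ξ.1).im) ^ 2 := by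
      intro ξ
      rw [hW, ← mul_assoc, ← Real.rpow_add ξ.len_pos, mul_pow, ← Real.rpow_natCast,
        ← Real.rpow_mul ξ.len_pos.le]
      congr 2
      push_cast
      ring
    have hsum : Summable fun ξ : Freq d => (ξ.len ^ (-2 - 2 * (ε : ℝ)) * W ξ) ^ 2 := by
      simp_rw [h2]
      refine ((hsm.summable_len_rpow_mul_sq (-4)).mul_left 2).of_nonneg_of_le
        (fun ξ => mul_nonneg (Real.rpow_pos_of_pos ξ.len_pos _).le (sq_nonneg _)) fun ξ => ?_
      rw [mul_left_comm]
      refine mul_le_mul_of_nonneg_left ?_ (Real.rpow_pos_of_pos ξ.len_pos _).le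
      rw [Complex.sq_norm, Complex.normSq_apply]
      nlinarith [sq_nonneg ((fourierCoef f ξ.1).re - (fourierCoef f ξ.1).im)]
    -- the cross terms `2 Re Im` are odd in `ξ`, so they cancel in the symmetrized sum
    have h3 : ∀ ξ : Freq d, ξ.len ^ (-4 : ℝ) * ‖fourierCoef f ξ.1‖ ^ 2
        = ((ξ.len ^ (-2 - 2 * (ε : ℝ)) * W ξ) ^ 2
          + (ξ.opp.len ^ (-2 - 2 * (ε : ℝ)) * W ξ.opp) ^ 2) / 2 := by
      intro ξ
      rw [h2, h2, hopp, Freq.len_opp, Complex.sq_norm, Complex.normSq_apply]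
      simp only [Complex.conj_re, Complex.conj_im]
      ring
    rw [tsum_congr h3, tsum_div_const, hsum.tsum_add (Freq.summable_comp_opp hsum),
      Freq.tsum_comp_opp (fun ξ => (ξ.len ^ (-2 - 2 * (ε : ℝ)) * W ξ) ^ 2)]
    ring

end Hartley

/-! ### Fourier analysis of the rescaled odometer -/

section CircleIntegral

theorem volume_unitAddCircle_eq :
    (volume : Measure UnitAddCircle) = AddCircle.haarAddCircle := by
  rw [AddCircle.volume_eq_smul_haarAddCircle]
  simp

theorem integral_exp_symm (m r : ℝ) :
    ∫ x in (-r)..r, Complex.exp (2 * Real.pi * Complex.I * m * x)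
      = ((2 * r * Real.sinc (2 * Real.pi * m * r) : ℝ) : ℂ) := by
  by_cases hm : m = 0
  · subst hm
    simp
    ring
  have hc : (2 * Real.pi * Complex.I * m : ℂ) ≠ 0 := by
    have := Real.pi_ne_zero
    have hm' : (m : ℂ) ≠ 0 := by exact_mod_cast hm
    simp [hm', this]
  rw [integral_exp_mul_complex hc]
  by_cases hr : r = 0
  · subst hr; simp
  have harg : 2 * Real.pi * m * r ≠ 0 := by
    have := Real.pi_ne_zero
    positivity
  rw [Real.sinc_of_ne_zero harg]
  have h1 : (2 * Real.pi * Complex.I * m : ℂ) * (r : ℂ)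
      = ((2 * Real.pi * m * r : ℝ) : ℂ) * Complex.I := by
    push_cast; ring
  have h2 : (2 * Real.pi * Complex.I * m : ℂ) * ((-r : ℝ) : ℂ)
      = -((2 * Real.pi * m * r : ℝ) : ℂ) * Complex.I := by
    push_cast; ring
  rw [h1, h2]
  have h3 := Complex.two_sin ((2 * Real.pi * m * r : ℝ) : ℂ)
  have h4 : Complex.exp (((2 * Real.pi * m * r : ℝ) : ℂ) * Complex.I)
      - Complex.exp (-((2 * Real.pi * m * r : ℝ) : ℂ) * Complex.I)
      = 2 * Complex.I * Complex.sin ((2 * Real.pi * m * r : ℝ) : ℂ) := by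
    rw [mul_right_comm 2 Complex.I, h3]
    linear_combination (Complex.exp (((2 * Real.pi * m * r : ℝ) : ℂ) * Complex.I)
      - Complex.exp (-((2 * Real.pi * m * r : ℝ) : ℂ) * Complex.I)) * Complex.I_sq
  rw [h4, ← Complex.ofReal_sin, Complex.ofReal_mul, Complex.ofReal_div]
  have hr' : (r : ℂ) ≠ 0 := by exact_mod_cast hr
  have hm' : (m : ℂ) ≠ 0 := by exact_mod_cast hm
  have hpi : (Real.pi : ℂ) ≠ 0 := by exact_mod_cast Real.pi_ne_zero
  have hI := Complex.I_ne_zero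
  push_cast
  field_simp

theorem integral_fourier_indicator_ball_zero (m : ℤ) {r : ℝ} (hr : 0 < r) (hr' : r ≤ 1 / 2) :
    ∫ z : UnitAddCircle, fourier m z * (Metric.ball (0 : UnitAddCircle) r).indicator 1 z
        ∂AddCircle.haarAddCircle
      = ((2 * r * Real.sinc (2 * Real.pi * m * r) : ℝ) : ℂ) := by
  rw [← volume_unitAddCircle_eq, ← UnitAddCircle.integral_preimage (-(1 / 2)), ← integral_exp_symm]
  rw [intervalIntegral.integral_of_le (by linarith), integral_Ioc_eq_integral_Ioo,
    integral_Ioc_eq_integral_Ioo, ← integral_indicator measurableSet_Ioo,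
    ← integral_indicator measurableSet_Ioo]
  refine integral_congr_ae (Eventually.of_forall fun x => ?_)
  have key : ∀ x : ℝ, |x| ≤ 1 / 2 → ((x : UnitAddCircle) ∈ Metric.ball (0 : UnitAddCircle) r
      ↔ x ∈ Set.Ioo (-r) r) := by
    intro x hx
    rw [mem_ball_zero_iff,
      (AddCircle.norm_coe_eq_abs_iff (p := 1) one_ne_zero).2 (by simpa using hx), abs_lt, Set.mem_Ioo]
  by_cases h1 : x ∈ Set.Ioo (-(1 / 2) : ℝ) (-(1 / 2) + 1)
  · rw [Set.indicator_of_mem h1]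
    have habs : |x| ≤ 1 / 2 := abs_le.2 ⟨h1.1.le, by linarith [h1.2]⟩
    by_cases h2 : x ∈ Set.Ioo (-r) r
    · rw [Set.indicator_of_mem h2, Set.indicator_of_mem ((key x habs).2 h2), fourier_coe_apply]
      simp
    · rw [Set.indicator_of_notMem h2, Set.indicator_of_notMem (fun h => h2 ((key x habs).1 h))]
      simp
  · rw [Set.indicator_of_notMem h1, Set.indicator_of_notMem]
    intro h2
    exact h1 ⟨by linarith [h2.1], by linarith [h2.2]⟩

theorem integral_fourier_indicator_ball (m : ℤ) (a : UnitAddCircle) {r : ℝ} (hr : 0 < r)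
    (hr' : r ≤ 1 / 2) :
    ∫ z : UnitAddCircle, fourier m z * (Metric.ball a r).indicator 1 z ∂AddCircle.haarAddCircle
      = fourier m a * ((2 * r * Real.sinc (2 * Real.pi * m * r) : ℝ) : ℂ) := by
  rw [← integral_fourier_indicator_ball_zero m hr hr', ← integral_const_mul,
    ← integral_add_right_eq_self _ a]
  refine integral_congr_ae (Eventually.of_forall fun z => ?_)
  have h1 : (Metric.ball a r).indicator (1 : UnitAddCircle → ℂ) (z + a)
      = (Metric.ball (0 : UnitAddCircle) r).indicator 1 z := by
    simp [Set.indicator, dist_eq_norm]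
  simp only [h1, fourier_apply, smul_add, AddCircle.toCircle_add, Circle.coe_mul]
  ring

end CircleIntegral

section Symbols

variable {d : ℕ}

/-- Minus the eigenvalue of the graph Laplacian at the frequency `ξ`. -/
def lapSymbol (n : ℕ) (ξ : Fin d → ℤ) : ℝ :=
  2 / (d : ℝ) * ∑ i, Real.sin (Real.pi * ξ i / n) ^ 2

/-- The Fourier coefficients of a box of side `1/n`, up to the factor `n⁻ᵈ`. -/
def boxSymbol (n : ℕ) (ξ : Fin d → ℤ) : ℝ := ∏ i, Real.sinc (Real.pi * ξ i / n)

theorem abs_boxSymbol_le_one (n : ℕ) (ξ : Fin d → ℤ) : |boxSymbol n ξ| ≤ 1 := by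
  rw [boxSymbol, Finset.abs_prod]
  exact Finset.prod_le_one (fun _ _ => abs_nonneg _) fun _ _ => Real.abs_sinc_le_one _

/-- The multiplier that maps the weights to the interpolated odometer. At the nonzero frequencies
in `nℤᵈ`, where the Laplacian is not invertible, it vanishes with the box symbol. -/
def odometerSymbol (n : ℕ) (ξ : Fin d → ℤ) : ℝ := boxSymbol n ξ / lapSymbol n ξ

end Symbols

section DiscreteFourier

variable {d n : ℕ} [NeZero n]

/-- The character `k ↦ exp(-2πi ξ·k/n)` of the discrete torus. -/
def character (n : ℕ) [NeZero n] (ξ : Fin d → ℤ) (k : DTorus d n) : ℂ :=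
  UnitAddTorus.mFourier (-ξ) (gridPoint k)

theorem gridPoint_add (k l : DTorus d n) : gridPoint (k + l) = gridPoint k + gridPoint l := by
  funext i
  simp [gridPoint]

theorem character_add (ξ : Fin d → ℤ) (k l : DTorus d n) :
    character n ξ (k + l) = character n ξ k * character n ξ l := by
  rw [character, gridPoint_add, mFourier_add_apply]
  rfl

theorem character_zero (ξ : Fin d → ℤ) : character n ξ 0 = 1 := by
  simp [character, UnitAddTorus.mFourier, gridPoint]

theorem norm_character (ξ : Fin d → ℤ) (k : DTorus d n) : ‖character n ξ k‖ = 1 := by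
  rw [character, UnitAddTorus.mFourier, ContinuousMap.coe_mk, norm_prod]
  exact Finset.prod_eq_one fun i _ => Circle.norm_coe _

theorem character_neg_freq (ξ : Fin d → ℤ) (k : DTorus d n) :
    character n (-ξ) k = conj (character n ξ k) := by
  rw [character, UnitAddTorus.mFourier_neg]
  rfl

theorem character_mul (ξ η : Fin d → ℤ) (k : DTorus d n) :
    character n ξ k * character n η k = character n (ξ + η) k := by
  rw [character, character, character, neg_add, UnitAddTorus.mFourier_add]

theorem character_neg (ξ : Fin d → ℤ) (k : DTorus d n) :
    character n ξ (-k) = conj (character n ξ k) := by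
  have h1 : character n ξ k * character n ξ (-k) = 1 := by
    rw [← character_add, add_neg_cancel, character_zero]
  have h2 : character n ξ k * conj (character n ξ k) = 1 := by
    rw [Complex.mul_conj, Complex.normSq_eq_norm_sq, norm_character]
    simp
  exact mul_left_cancel₀ (left_ne_zero_of_mul_eq_one h1) (h1.trans h2.symm)

theorem character_unitVec (ξ : Fin d → ℤ) (i : Fin d) :
    character n ξ (unitVec d n i)
      = Complex.exp (-((2 * (Real.pi * ξ i / n) : ℝ) : ℂ) * Complex.I) := by
  have h1 : gridPoint (unitVec d n i) = Pi.single i (((1 : ℝ) / n : ℝ) : UnitAddCircle) := by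
    funext j
    by_cases h : j = i
    · subst h
      simp only [gridPoint, unitVec, Pi.single_eq_same]
      have := ZMod.toAddCircle_intCast (N := n) 1
      simpa using this
    · simp [gridPoint, unitVec, h]
  rw [character, h1, mFourier_single_apply]
  congr 1
  simp only [Pi.neg_apply]
  push_cast
  ring

theorem character_unitVec_add_conj (ξ : Fin d → ℤ) (i : Fin d) :
    conj (character n ξ (unitVec d n i)) + character n ξ (unitVec d n i)
      = ((2 - 4 * Real.sin (Real.pi * ξ i / n) ^ 2 : ℝ) : ℂ) := by
  rw [add_comm, Complex.add_conj, character_unitVec, ← Complex.ofReal_neg,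
    Complex.exp_ofReal_mul_I_re, Real.cos_neg, Real.cos_two_mul, Real.cos_sq']
  push_cast
  ring

theorem character_unitVec_ne_one {ξ : Fin d → ℤ} {i : Fin d} (h : ¬ (n : ℤ) ∣ ξ i) :
    character n ξ (unitVec d n i) ≠ 1 := by
  intro h1
  rw [character_unitVec, Complex.exp_eq_one_iff] at h1
  obtain ⟨m, hm⟩ := h1
  apply h
  refine ⟨-m, ?_⟩
  have hn : (n : ℂ) ≠ 0 := Nat.cast_ne_zero.2 (NeZero.ne n)
  have hpi : (Real.pi : ℂ) ≠ 0 := by exact_mod_cast Real.pi_ne_zero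
  have hI := Complex.I_ne_zero
  push_cast at hm
  field_simp at hm
  have h2 : (ξ i : ℂ) = (n : ℂ) * (-m) := by linear_combination -hm
  exact_mod_cast h2

theorem sum_character_eq_zero {ξ : Fin d → ℤ} {i : Fin d} (h : ¬ (n : ℤ) ∣ ξ i) :
    ∑ k : DTorus d n, character n ξ k = 0 := by
  have h1 : ∑ k : DTorus d n, character n ξ (k + unitVec d n i)
      = ∑ k : DTorus d n, character n ξ k :=
    Equiv.sum_comp (Equiv.addRight (unitVec d n i)) (character n ξ)
  simp only [character_add, ← Finset.sum_mul] at h1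
  have h2 := character_unitVec_ne_one h
  by_contra h3
  exact h2 (mul_left_cancel₀ h3 (h1.trans (mul_one _).symm))

theorem character_eq_one {ξ : Fin d → ℤ} (h : ∀ i, (n : ℤ) ∣ ξ i) (k : DTorus d n) :
    character n ξ k = 1 := by
  have hn : (n : ℂ) ≠ 0 := Nat.cast_ne_zero.2 (NeZero.ne n)
  rw [character, UnitAddTorus.mFourier, ContinuousMap.coe_mk]
  refine Finset.prod_eq_one fun i _ => ?_
  obtain ⟨m, hm⟩ := h i
  obtain ⟨j, hj⟩ := ZMod.intCast_surjective (k i)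
  rw [gridPoint, ← hj, ZMod.toAddCircle_intCast, fourier_coe_apply, Complex.exp_eq_one_iff]
  refine ⟨-m * j, ?_⟩
  simp only [Pi.neg_apply, hm]
  push_cast
  field_simp

theorem sum_character_of_dvd {ξ : Fin d → ℤ} (h : ∀ i, (n : ℤ) ∣ ξ i) :
    ∑ k : DTorus d n, character n ξ k = (n : ℂ) ^ d := by
  simp [character_eq_one h, ZMod.card]

/-- The discrete Fourier transform `∑ u(k) exp(-2πi ξ·k/n)`. -/
def dft (u : DTorus d n → ℝ) (ξ : Fin d → ℤ) : ℂ := ∑ k, (u k : ℂ) * character n ξ k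

theorem dft_neg_freq (u : DTorus d n → ℝ) (ξ : Fin d → ℤ) : dft u (-ξ) = conj (dft u ξ) := by
  simp [dft, character_neg_freq]

theorem dft_lap (hd : 1 ≤ d) (v : DTorus d n → ℝ) (ξ : Fin d → ℤ) :
    dft (lap d n v) ξ = -(lapSymbol n ξ : ℂ) * dft v ξ := by
  have hd' : (d : ℂ) ≠ 0 := by exact_mod_cast (by omega : d ≠ 0)
  have h1 : ∀ i : Fin d, ∑ k, (v (k + unitVec d n i) : ℂ) * character n ξ k
      = conj (character n ξ (unitVec d n i)) * dft v ξ := by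
    intro i
    rw [← Equiv.sum_comp (Equiv.subRight (unitVec d n i))
      (fun k => (v (k + unitVec d n i) : ℂ) * character n ξ k), dft, Finset.mul_sum]
    refine Finset.sum_congr rfl fun k _ => ?_
    simp only [Equiv.subRight_apply, sub_add_cancel]
    rw [sub_eq_add_neg, character_add, character_neg]
    ring
  have h2 : ∀ i : Fin d, ∑ k, (v (k - unitVec d n i) : ℂ) * character n ξ k
      = character n ξ (unitVec d n i) * dft v ξ := by
    intro i
    rw [← Equiv.sum_comp (Equiv.addRight (unitVec d n i))
      (fun k => (v (k - unitVec d n i) : ℂ) * character n ξ k), dft, Finset.mul_sum]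
    refine Finset.sum_congr rfl fun k _ => ?_
    simp only [Equiv.coe_addRight, add_sub_cancel_right, character_add]
    ring
  have h3 : dft (lap d n v) ξ = (2 * (d : ℂ))⁻¹ * ∑ i : Fin d,
      (∑ k, (v (k + unitVec d n i) : ℂ) * character n ξ k
        + ∑ k, (v (k - unitVec d n i) : ℂ) * character n ξ k) - dft v ξ := by
    simp only [dft, lap_apply, ← Finset.sum_add_distrib]
    rw [Finset.sum_comm, Finset.mul_sum, ← Finset.sum_sub_distrib]
    refine Finset.sum_congr rfl fun k _ => ?_
    push_cast
    rw [sub_mul, mul_assoc, Finset.sum_mul]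
    simp only [add_mul]
  rw [h3]
  simp only [h1, h2, ← add_mul, ← Finset.sum_mul, character_unitVec_add_conj]
  rw [lapSymbol, ← Complex.ofReal_sum, Finset.sum_sub_distrib, ← Finset.mul_sum]
  simp only [Finset.sum_const, Finset.card_univ, Fintype.card_fin, nsmul_eq_mul]
  push_cast
  field_simp
  ring

/-- The Fourier integral over each box factors into one-dimensional integrals. -/
theorem fourierCoef_interpolation (u : DTorus d n → ℝ) (ξ : Fin d → ℤ) :
    fourierCoef (interpolation u) ξ = ((n : ℂ) ^ d)⁻¹ * boxSymbol n ξ * dft u ξ := by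
  have hn : (0 : ℝ) < n := Nat.cast_pos.2 (NeZero.pos n)
  have hn1 : (1 : ℝ) ≤ n := by exact_mod_cast NeZero.one_le
  have hr : (0 : ℝ) < 1 / (2 * n) := by positivity
  have hr' : (1 : ℝ) / (2 * n) ≤ 1 / 2 := one_div_le_one_div_of_le (by norm_num) (by linarith)
  have hbox : ∀ k : DTorus d n, ∫ z, UnitAddTorus.mFourier (-ξ) z
      * ((Metric.ball (gridPoint k) (1 / (2 * (n : ℝ)))).indicator (fun _ => (1 : ℂ)) z)
        ∂(torusMeasure d) = ((n : ℂ) ^ d)⁻¹ * boxSymbol n ξ * character n ξ k := by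
    intro k
    have h1 : ∀ z : Torus d, UnitAddTorus.mFourier (-ξ) z
        * ((Metric.ball (gridPoint k) (1 / (2 * (n : ℝ)))).indicator (fun _ => (1 : ℂ)) z)
        = ∏ i, (fourier (-ξ i) (z i)
          * (Metric.ball (gridPoint k i) (1 / (2 * (n : ℝ)))).indicator 1 (z i)) := by
      intro z
      rw [Finset.prod_mul_distrib, ball_pi _ hr]
      congr 1
      by_cases hz : z ∈ Set.pi Set.univ fun i => Metric.ball (gridPoint k i) (1 / (2 * (n : ℝ)))
      · rw [Set.indicator_of_mem hz]
        refine (Finset.prod_eq_one fun i _ => ?_).symm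
        rw [Set.indicator_of_mem (hz i (Set.mem_univ i))]
        rfl
      · rw [Set.indicator_of_notMem hz]
        simp only [Set.mem_pi, Set.mem_univ, forall_true_left, not_forall] at hz
        obtain ⟨i, hi⟩ := hz
        exact (Finset.prod_eq_zero (Finset.mem_univ i) (Set.indicator_of_notMem hi _)).symm
    simp_rw [h1]
    rw [torusMeasure, integral_fintype_prod_eq_prod (𝕜 := ℂ)
      (fun i (z : UnitAddCircle) => fourier (-ξ i) z
        * (Metric.ball (gridPoint k i) (1 / (2 * (n : ℝ)))).indicator 1 z)]
    simp_rw [integral_fourier_indicator_ball _ _ hr hr']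
    rw [Finset.prod_mul_distrib, mul_comm, ← Complex.ofReal_prod]
    congr 1
    · have : ∀ i, 2 * (1 / (2 * (n : ℝ)))
          * Real.sinc (2 * Real.pi * ((-ξ i : ℤ) : ℝ) * (1 / (2 * n)))
          = (n : ℝ)⁻¹ * Real.sinc (Real.pi * ξ i / n) := by
        intro i
        rw [← Real.sinc_neg]
        congr 1
        · field_simp
        · congr 1
          push_cast
          field_simp
      simp_rw [this]
      rw [Finset.prod_mul_distrib, boxSymbol]
      simp
  have h2 : ∀ z : Torus d, UnitAddTorus.mFourier (-ξ) z * (interpolation u z : ℂ)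
      = ∑ k, (u k : ℂ) * (UnitAddTorus.mFourier (-ξ) z
        * ((Metric.ball (gridPoint k) (1 / (2 * (n : ℝ)))).indicator (fun _ => (1 : ℂ)) z)) := by
    intro z
    rw [interpolation, Complex.ofReal_sum, Finset.mul_sum]
    refine Finset.sum_congr rfl fun k _ => ?_
    rw [Complex.ofReal_mul, mul_left_comm]
    congr 2
    by_cases hz : z ∈ Metric.ball (gridPoint k) (1 / (2 * (n : ℝ)))
    · rw [Set.indicator_of_mem hz, Set.indicator_of_mem hz, Complex.ofReal_one]
    · rw [Set.indicator_of_notMem hz, Set.indicator_of_notMem hz, Complex.ofReal_zero]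
  rw [fourierCoef]
  simp_rw [h2]
  rw [integral_finsetSum, dft, Finset.mul_sum]
  · refine Finset.sum_congr rfl fun k _ => ?_
    rw [integral_const_mul, hbox]
    ring
  · intro k _
    refine Integrable.const_mul ?_ _
    refine Integrable.bdd_mul (c := 1) ((integrable_const (1 : ℂ)).indicator measurableSet_ball)
      (UnitAddTorus.mFourier (-ξ)).continuous.aestronglyMeasurable
      (Eventually.of_forall fun z => ?_)
    exact ((UnitAddTorus.mFourier (-ξ)).norm_coe_le_norm z).trans UnitAddTorus.mFourier_norm.le

theorem sin_sq_ge {m : ℤ} (h : ¬ (n : ℤ) ∣ m) :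
    4 / (n : ℝ) ^ 2 ≤ Real.sin (Real.pi * m / n) ^ 2 := by
  have hn : (0 : ℝ) < n := Nat.cast_pos.2 (NeZero.pos n)
  -- reduce to the representative `w` in `(-n/2, n/2]`
  set w : ℤ := (m : ZMod n).valMinAbs with hw
  have h1 : ((m - w : ℤ) : ZMod n) = 0 := by simp [hw]
  obtain ⟨q, hq⟩ := (ZMod.intCast_zmod_eq_zero_iff_dvd _ _).1 h1
  have hw0 : w ≠ 0 := by
    intro h0
    apply h
    rw [← ZMod.intCast_zmod_eq_zero_iff_dvd]
    exact (ZMod.valMinAbs_eq_zero _).1 h0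
  have hm : (m : ℝ) = w + n * q := by
    have : m = w + n * q := by linarith
    exact_mod_cast this
  have h2 : Real.sin (Real.pi * m / n) ^ 2 = Real.sin (Real.pi * |(w : ℝ)| / n) ^ 2 := by
    have e : Real.pi * m / n = Real.pi * w / n + q * Real.pi := by
      rw [hm]; field_simp
    have e1 : ∀ t : ℝ, Real.sin t ^ 2 = 1 / 2 - Real.cos (2 * t) / 2 := Real.sin_sq_eq_half_sub
    rw [e, e1, e1, mul_add, show 2 * (q * Real.pi) = q * (2 * Real.pi) by ring,
      Real.cos_add_int_mul_two_pi]
    rcases abs_choice (w : ℝ) with h | h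
    · rw [h]
    · rw [h, ← Real.cos_neg]
      congr 3
      ring
  have hb := ZMod.valMinAbs_mem_Ioc (m : ZMod n)
  rw [← hw] at hb
  have hwle : |(w : ℝ)| ≤ n / 2 := by
    have h3 : -(n : ℝ) < w * 2 := by exact_mod_cast hb.1
    have h4 : (w : ℝ) * 2 ≤ n := by exact_mod_cast hb.2
    exact abs_le.2 ⟨by linarith, by linarith⟩
  have hw1 : (1 : ℝ) ≤ |(w : ℝ)| := by exact_mod_cast Int.one_le_abs hw0
  have h5 : Real.pi * |(w : ℝ)| / n ≤ Real.pi / 2 := by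
    rw [div_le_div_iff₀ hn (by norm_num)]
    nlinarith [Real.pi_pos]
  have h6 := Real.mul_le_sin (x := Real.pi * |(w : ℝ)| / n) (by positivity) h5
  have h7 : 2 / (n : ℝ) ≤ 2 / Real.pi * (Real.pi * |(w : ℝ)| / n) := by
    have : 2 / Real.pi * (Real.pi * |(w : ℝ)| / n) = 2 / n * |(w : ℝ)| := by
      have := Real.pi_ne_zero
      field_simp
    rw [this]
    exact le_mul_of_one_le_right (by positivity) hw1
  rw [h2]
  calc 4 / (n : ℝ) ^ 2 = (2 / (n : ℝ)) ^ 2 := by ring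
    _ ≤ _ := pow_le_pow_left₀ (by positivity) (h7.trans h6) 2

theorem lapSymbol_ge (hd : 1 ≤ d) {ξ : Fin d → ℤ} {i : Fin d} (h : ¬ (n : ℤ) ∣ ξ i) :
    8 / ((d : ℝ) * (n : ℝ) ^ 2) ≤ lapSymbol n ξ := by
  have hd' : (0 : ℝ) < d := by exact_mod_cast hd
  have h1 := Finset.single_le_sum (f := fun i => Real.sin (Real.pi * ξ i / n) ^ 2)
    (fun _ _ => sq_nonneg _) (Finset.mem_univ i)
  calc 8 / ((d : ℝ) * (n : ℝ) ^ 2) = 2 / (d : ℝ) * (4 / (n : ℝ) ^ 2) := by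
        rw [div_mul_div_comm]; norm_num
    _ ≤ _ := mul_le_mul_of_nonneg_left ((sin_sq_ge h).trans h1) (by positivity)

theorem boxSymbol_eq_zero {ξ : Fin d → ℤ} (hξ : ξ ≠ 0) (h : ∀ i, (n : ℤ) ∣ ξ i) :
    boxSymbol n ξ = 0 := by
  have hn : (n : ℝ) ≠ 0 := Nat.cast_ne_zero.2 (NeZero.ne n)
  obtain ⟨i, hi⟩ := Function.ne_iff.1 hξ
  refine Finset.prod_eq_zero (Finset.mem_univ i) ?_
  have hi' : (ξ i : ℝ) ≠ 0 := Int.cast_ne_zero.2 hi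
  rw [Real.sinc_of_ne_zero (by have := Real.pi_ne_zero; positivity)]
  obtain ⟨m, hm⟩ := h i
  have : Real.pi * ξ i / n = m * Real.pi := by
    rw [hm]; push_cast; field_simp
  rw [this, Real.sin_int_mul_pi, zero_div]

theorem abs_odometerSymbol_le (hd : 1 ≤ d) {ξ : Fin d → ℤ} (hξ : ξ ≠ 0) :
    |odometerSymbol n ξ| ≤ (d : ℝ) * (n : ℝ) ^ 2 / 8 := by
  have hn : (0 : ℝ) < n := Nat.cast_pos.2 (NeZero.pos n)
  have hd' : (0 : ℝ) < d := by exact_mod_cast hd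
  by_cases h : ∀ i, (n : ℤ) ∣ ξ i
  · rw [odometerSymbol, boxSymbol_eq_zero hξ h, zero_div, abs_zero]
    positivity
  · push Not at h
    obtain ⟨i, hi⟩ := h
    have h1 := lapSymbol_ge hd hi
    have h2 : 0 < lapSymbol n ξ := lt_of_lt_of_le (by positivity) h1
    rw [odometerSymbol, abs_div, abs_of_pos h2]
    calc |boxSymbol n ξ| / lapSymbol n ξ ≤ 1 / (8 / ((d : ℝ) * (n : ℝ) ^ 2)) :=
          div_le_div₀ zero_le_one (abs_boxSymbol_le_one n ξ) (by positivity) h1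
      _ = _ := by rw [one_div_div]

/-- The Fourier coefficients of the interpolated odometer are those of the weights, multiplied
by the symbol. -/
theorem coeff_field_odometer (hd : 1 ≤ d) (ε : ℝ≥0) (σ : DTorus d n → ℝ) (ξ : Freq d) :
    (field ε (odometer (initialConfig σ))).coeff ξ
      = ((n : ℂ) ^ d)⁻¹ * odometerSymbol n ξ.1 * dft σ ξ.1 := by
  change fourierCoef (interpolation (odometer (initialConfig σ))) ξ.1 = _
  rw [fourierCoef_interpolation]
  by_cases h : ∀ i, (n : ℤ) ∣ ξ.1 i
  · simp [odometerSymbol, boxSymbol_eq_zero ξ.2 h]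
  · push Not at h
    obtain ⟨i, hi⟩ := h
    have hn : (0 : ℝ) < n := Nat.cast_pos.2 (NeZero.pos n)
    have hd' : (0 : ℝ) < d := by exact_mod_cast hd
    have h2 : lapSymbol n ξ.1 ≠ 0 := (lt_of_lt_of_le (by positivity) (lapSymbol_ge hd hi)).ne'
    have h3 : dft (lap d n (odometer (initialConfig σ))) ξ.1 = -dft σ ξ.1 := by
      have : ∀ k, lap d n (odometer (initialConfig σ)) k
          = ((n : ℝ) ^ d)⁻¹ * ∑ z, σ z - σ k := by
        intro k
        rw [lap_odometer hd (sum_initialConfig_sub_one σ), initialConfig]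
        ring
      simp only [dft, this, Complex.ofReal_sub, sub_mul, Finset.sum_sub_distrib, ← Finset.mul_sum,
        sum_character_eq_zero hi, mul_zero, zero_sub]
    rw [dft_lap hd] at h3
    have h2' : (lapSymbol n ξ.1 : ℂ) ≠ 0 := by exact_mod_cast h2
    have h4 : dft (odometer (initialConfig σ)) ξ.1 = dft σ ξ.1 / lapSymbol n ξ.1 := by
      rw [eq_div_iff h2']
      linear_combination -h3
    rw [h4, odometerSymbol]
    push_cast
    ring

theorem tendsto_odometerSymbol (hd : 1 ≤ d) (ξ : Freq d) :
    Tendsto (fun n : ℕ => odometerSymbol n ξ.1 / (n : ℝ) ^ 2) atTop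
      (𝓝 ((d : ℝ) / (2 * Real.pi ^ 2) * (ξ.len ^ 2)⁻¹)) := by
  have hlim : ∀ i, Tendsto (fun n : ℕ => Real.pi * (ξ.1 i : ℝ) / n) atTop (𝓝 0) := fun i =>
    tendsto_const_div_atTop_nhds_zero_nat _
  have hsinc : ∀ i, Tendsto (fun n : ℕ => Real.sinc (Real.pi * (ξ.1 i : ℝ) / n)) atTop (𝓝 1) := by
    intro i
    have := (Real.continuous_sinc.tendsto 0).comp (hlim i)
    rwa [Real.sinc_zero] at this
  have hbox : Tendsto (fun n : ℕ => boxSymbol n ξ.1) atTop (𝓝 1) := by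
    have := tendsto_finsetProd Finset.univ fun i _ => hsinc i
    simpa only [boxSymbol, Finset.prod_const_one] using this
  have hsin : ∀ i, Tendsto (fun n : ℕ => (n : ℝ) ^ 2 * Real.sin (Real.pi * (ξ.1 i : ℝ) / n) ^ 2)
      atTop (𝓝 ((Real.pi * ξ.1 i) ^ 2)) := by
    intro i
    have h1 := ((hsinc i).const_mul (Real.pi * (ξ.1 i : ℝ))).pow 2
    rw [mul_one] at h1
    refine h1.congr' ?_
    filter_upwards [eventually_gt_atTop 0] with n hn
    have hn' : (n : ℝ) ≠ 0 := by positivity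
    by_cases h0 : ξ.1 i = 0
    · simp [h0]
    · have h0' : (ξ.1 i : ℝ) ≠ 0 := Int.cast_ne_zero.2 h0
      have hpi := Real.pi_ne_zero
      rw [Real.sinc_of_ne_zero (by positivity)]
      field_simp
  have hlap : Tendsto (fun n : ℕ => (n : ℝ) ^ 2 * lapSymbol n ξ.1) atTop
      (𝓝 (2 / (d : ℝ) * ∑ i, (Real.pi * (ξ.1 i : ℝ)) ^ 2)) := by
    refine ((tendsto_finsetSum Finset.univ fun i _ => hsin i).const_mul (2 / (d : ℝ))).congr
      fun n => ?_
    rw [lapSymbol, ← Finset.mul_sum]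
    ring
  have hd' : (d : ℝ) ≠ 0 := by positivity
  have hlen := ξ.len_pos.ne'
  have hpi := Real.pi_ne_zero
  have hval : 2 / (d : ℝ) * ∑ i, (Real.pi * (ξ.1 i : ℝ)) ^ 2
      = 2 / (d : ℝ) * Real.pi ^ 2 * ξ.len ^ 2 := by
    simp only [mul_pow, ← Finset.mul_sum]
    rw [ξ.len_sq]
    ring
  rw [hval] at hlap
  have := hbox.div hlap (by positivity)
  refine (this.congr fun n => ?_).trans (le_of_eq ?_)
  · rw [odometerSymbol, div_div, mul_comm]
    rfl
  · congr 1
    field_simp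

end DiscreteFourier

/-! ### Covariances of the Hartley coefficients -/

section ToHartley

variable {d : ℕ} {ε : ℝ≥0}

/-- The weighted Hartley coefficients `‖ξ‖^(-2ε) (Re ĥ(ξ) + Im ĥ(ξ))` of an element of `H^{-ε}`. -/
def toHartley (h : NegSobolev d ε) : RealEllTwo d :=
  ⟨fun ξ => ξ.len ^ (-2 * (ε : ℝ)) * ((h.coeff ξ).re + (h.coeff ξ).im), by
    refine memℓp_two_of_summable_sq ((h.2.2.mul_left 2).of_nonneg_of_le (fun ξ => sq_nonneg _)
      fun ξ => ?_)
    rw [mul_pow, ← Real.rpow_natCast, ← Real.rpow_mul ξ.len_pos.le, mul_left_comm,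
      show -2 * (ε : ℝ) * ((2 : ℕ) : ℝ) = -4 * ε by push_cast; ring]
    refine mul_le_mul_of_nonneg_left ?_ (Real.rpow_pos_of_pos ξ.len_pos _).le
    rw [Complex.sq_norm, Complex.normSq_apply]
    change ((h.coeff ξ).re + (h.coeff ξ).im) ^ 2
      ≤ 2 * ((h.coeff ξ).re * (h.coeff ξ).re + (h.coeff ξ).im * (h.coeff ξ).im)
    nlinarith [sq_nonneg ((h.coeff ξ).re - (h.coeff ξ).im)]⟩

theorem toHartley_apply (h : NegSobolev d ε) (ξ : Freq d) :
    toHartley h ξ = ξ.len ^ (-2 * (ε : ℝ)) * ((h.coeff ξ).re + (h.coeff ξ).im) := rfl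

theorem ofHartley_toHartley (h : NegSobolev d ε) : ofHartley d ε (toHartley h) = h := by
  refine NegSobolev.ext fun ξ => ?_
  have h1 : hermitian (fun ξ => toHartley h ξ) ξ
      = ((ξ.len ^ (-2 * (ε : ℝ)) : ℝ) : ℂ) * h.coeff ξ := by
    rw [← hermitian_re_add_im (z := fun ξ => ((ξ.len ^ (-2 * (ε : ℝ)) : ℝ) : ℂ) * h.coeff ξ)]
    · congr 1
      funext η
      rw [toHartley_apply, Complex.re_ofReal_mul, Complex.im_ofReal_mul, mul_add]
    · intro η
      have : h.coeff η.opp = conj (h.coeff η) := h.2.1 η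
      rw [Freq.len_opp, this, map_mul, Complex.conj_ofReal]
  rw [coeff_ofHartley, h1, ← mul_assoc, ← Complex.ofReal_mul, ← Real.rpow_add ξ.len_pos]
  simp

end ToHartley

section DiscreteHartley

variable {d n : ℕ} [NeZero n]

/-- The Hartley kernel `cos(2π ξ·k/n) - sin(2π ξ·k/n)`. -/
def hartleyKernel (n : ℕ) [NeZero n] (ξ : Fin d → ℤ) (k : DTorus d n) : ℝ :=
  (character n ξ k).re + (character n ξ k).im

/-- The discrete Hartley transform. -/
def dht (u : DTorus d n → ℝ) (ξ : Fin d → ℤ) : ℝ := ∑ k, u k * hartleyKernel n ξ k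

theorem dft_re_add_im (u : DTorus d n → ℝ) (ξ : Fin d → ℤ) :
    (dft u ξ).re + (dft u ξ).im = dht u ξ := by
  simp only [dft, dht, hartleyKernel, Complex.re_sum, Complex.im_sum, Complex.re_ofReal_mul,
    Complex.im_ofReal_mul, mul_add, Finset.sum_add_distrib]

/-- The Hartley coefficients of the multiple `b` of the field of the odometer. -/
def hartleyField (ε : ℝ≥0) (b : ℝ) (σ : DTorus d n → ℝ) : RealEllTwo d :=
  toHartley (b • field ε (odometer (initialConfig σ)))

theorem hartleyField_apply (hd : 1 ≤ d) (ε : ℝ≥0) (b : ℝ) (σ : DTorus d n → ℝ) (ξ : Freq d) :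
    hartleyField ε b σ ξ
      = ξ.len ^ (-2 * (ε : ℝ)) * (b * ((n : ℝ) ^ d)⁻¹ * odometerSymbol n ξ.1) * dht σ ξ.1 := by
  have h1 : (b • field ε (odometer (initialConfig σ))).coeff ξ
      = ((b * ((n : ℝ) ^ d)⁻¹ * odometerSymbol n ξ.1 : ℝ) : ℂ) * dft σ ξ.1 := by
    change b • (field ε (odometer (initialConfig σ))).coeff ξ = _
    rw [coeff_field_odometer hd, Complex.real_smul]
    push_cast
    ring
  rw [hartleyField, toHartley_apply, h1, Complex.re_ofReal_mul, Complex.im_ofReal_mul, ← mul_add,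
    dft_re_add_im]
  ring

/-- `hartleyField` as a continuous linear map: modulo constants the odometer is linear in the
weights. -/
def hartleyFieldCLM (hd : 1 ≤ d) (ε : ℝ≥0) (b : ℝ) : (DTorus d n → ℝ) →L[ℝ] RealEllTwo d :=
  LinearMap.toContinuousLinearMap
    { toFun := hartleyField ε b
      map_add' := fun σ τ => by
        apply lp.ext
        funext ξ
        rw [lp.coeFn_add, Pi.add_apply]
        simp only [hartleyField_apply hd, dht, Pi.add_apply, add_mul, Finset.sum_add_distrib,
          mul_add]
      map_smul' := fun r σ => by
        apply lp.ext
        funext ξ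
        rw [lp.coeFn_smul, Pi.smul_apply]
        simp only [hartleyField_apply hd, dht, Pi.smul_apply, smul_eq_mul, RingHom.id_apply,
          mul_assoc, ← Finset.mul_sum]
        ring }

/-- The average of the character of frequency `ξ` over the discrete torus: `1` if `ξ ∈ nℤᵈ`, and
`0` otherwise. -/
def meanCharacter (n : ℕ) (ξ : Fin d → ℤ) : ℝ := by
  classical exact if ∀ i, (n : ℤ) ∣ ξ i then 1 else 0

theorem sum_character (ξ : Fin d → ℤ) :
    ∑ k : DTorus d n, character n ξ k = (((n : ℝ) ^ d * meanCharacter n ξ : ℝ) : ℂ) := by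
  rw [meanCharacter]
  split_ifs with h
  · rw [sum_character_of_dvd h]
    simp
  · push Not at h
    obtain ⟨i, hi⟩ := h
    rw [sum_character_eq_zero hi]
    simp

theorem sum_sum_character (κ : DTorus d n → ℝ) (ξ η : Fin d → ℤ) :
    ∑ x, ∑ y, (κ (x - y) : ℂ) * (character n ξ x * character n η y)
      = dft κ ξ * (((n : ℝ) ^ d * meanCharacter n (ξ + η) : ℝ) : ℂ) := by
  rw [Finset.sum_comm, ← sum_character, Finset.mul_sum]
  refine Finset.sum_congr rfl fun y _ => ?_
  rw [← Equiv.sum_comp (Equiv.addRight y), dft, Finset.sum_mul]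
  refine Finset.sum_congr rfl fun z _ => ?_
  simp only [Equiv.coe_addRight, add_sub_cancel_right]
  rw [character_add, ← character_mul]
  ring

theorem hartleyKernel_mul (ξ η : Fin d → ℤ) (x y : DTorus d n) :
    hartleyKernel n ξ x * hartleyKernel n η y
      = (character n ξ x * character n (-η) y).re + (character n ξ x * character n η y).im := by
  rw [character_neg_freq]
  simp only [hartleyKernel, Complex.mul_re, Complex.mul_im, Complex.conj_re, Complex.conj_im]
  ring

/-- The covariance of the Hartley coefficients of a stationary family. -/
theorem integral_dht_mul_dht {Ω : Type*} [MeasurableSpace Ω] {P : Measure Ω}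
    {σ : Ω → DTorus d n → ℝ} (hint : ∀ x y, Integrable (fun ω => σ ω x * σ ω y) P)
    {κ : DTorus d n → ℝ} (hcov : ∀ x y, ∫ ω, σ ω x * σ ω y ∂P = κ (x - y)) (ξ η : Fin d → ℤ) :
    ∫ ω, dht (σ ω) ξ * dht (σ ω) η ∂P
      = (n : ℝ) ^ d * ((dft κ ξ).re * meanCharacter n (ξ - η)
          + (dft κ ξ).im * meanCharacter n (ξ + η)) := by
  have h1 : ∀ ω, dht (σ ω) ξ * dht (σ ω) η
      = ∑ x, ∑ y, (hartleyKernel n ξ x * hartleyKernel n η y) * (σ ω x * σ ω y) := by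
    intro ω
    rw [dht, dht, Finset.sum_mul_sum]
    refine Finset.sum_congr rfl fun x _ => Finset.sum_congr rfl fun y _ => ?_
    ring
  simp_rw [h1]
  rw [integral_finsetSum _ fun x _ => integrable_finsetSum _ fun y _ => (hint x y).const_mul _]
  have h2 : ∀ x, ∫ ω, ∑ y, (hartleyKernel n ξ x * hartleyKernel n η y) * (σ ω x * σ ω y) ∂P
      = ∑ y, ((κ (x - y) : ℂ) * (character n ξ x * character n (-η) y)).re
        + ∑ y, ((κ (x - y) : ℂ) * (character n ξ x * character n η y)).im := by
    intro x
    rw [integral_finsetSum _ fun y _ => (hint x y).const_mul _, ← Finset.sum_add_distrib]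
    refine Finset.sum_congr rfl fun y _ => ?_
    rw [integral_const_mul, hcov, hartleyKernel_mul, Complex.re_ofReal_mul, Complex.im_ofReal_mul]
    ring
  simp_rw [h2]
  rw [Finset.sum_add_distrib]
  simp only [← Complex.re_sum, ← Complex.im_sum]
  rw [sum_sum_character, sum_sum_character, Complex.re_mul_ofReal, Complex.im_mul_ofReal,
    ← sub_eq_add_neg]
  ring

theorem norm_dft_le (u : DTorus d n → ℝ) (ξ : Fin d → ℤ) : ‖dft u ξ‖ ≤ ∑ k, |u k| := by
  refine (norm_sum_le _ _).trans (Finset.sum_le_sum fun k _ => ?_)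
  rw [norm_mul, norm_character, mul_one, Complex.norm_real, Real.norm_eq_abs]

end DiscreteHartley

theorem meanCharacter_zero {d : ℕ} (n : ℕ) : meanCharacter n (0 : Fin d → ℤ) = 1 := by
  simp [meanCharacter]

theorem abs_meanCharacter_le_one {d : ℕ} (n : ℕ) (ξ : Fin d → ℤ) : |meanCharacter n ξ| ≤ 1 := by
  rw [meanCharacter]
  split_ifs <;> simp

theorem eventually_meanCharacter_eq_zero {d : ℕ} {ξ : Fin d → ℤ} (hξ : ξ ≠ 0) :
    ∀ᶠ n : ℕ in atTop, meanCharacter n ξ = 0 := by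
  obtain ⟨i, hi⟩ := Function.ne_iff.1 hξ
  filter_upwards [eventually_gt_atTop (ξ i).natAbs] with n hn
  rw [meanCharacter, if_neg]
  intro h
  exact hi (Int.eq_zero_of_dvd_of_natAbs_lt_natAbs (h i) (by simpa using hn))

/-! ### Convergence of the spectral densities -/

section Kernel

variable {d : ℕ}

theorem centeredRep_injective {n : ℕ} : Function.Injective (centeredRep (d := d) (n := n)) := by
  intro x y h
  funext i
  exact ZMod.injective_valMinAbs (congrFun h i)

/-- The reduction of an integer vector modulo `n`. -/
def reduceMod (d n : ℕ) (w : Fin d → ℤ) : DTorus d n := fun i => (w i : ZMod n)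

theorem reduceMod_centeredRep {n : ℕ} (x : DTorus d n) : reduceMod d n (centeredRep x) = x := by
  funext i
  exact ZMod.coe_valMinAbs (x i)

theorem eventually_centeredRep_reduceMod (w : Fin d → ℤ) :
    ∀ᶠ n : ℕ in atTop, centeredRep (reduceMod d n w) = w := by
  filter_upwards [eventually_gt_atTop (∑ i, 2 * (w i).natAbs)] with n hn
  have : NeZero n := ⟨by omega⟩
  funext i
  have h1 : 2 * (w i).natAbs ≤ ∑ i, 2 * (w i).natAbs :=
    Finset.single_le_sum (f := fun i => 2 * (w i).natAbs) (fun _ _ => Nat.zero_le _)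
      (Finset.mem_univ i)
  refine (ZMod.valMinAbs_spec _ _).2 ⟨rfl, ?_, ?_⟩ <;> omega

theorem tendsto_character_reduceMod (ξ w : Fin d → ℤ) :
    Tendsto (fun n : ℕ+ => character (n : ℕ) ξ (reduceMod d n w)) atTop (𝓝 1) := by
  have h1 : ∀ n : ℕ+, character (n : ℕ) ξ (reduceMod d n w)
      = UnitAddTorus.mFourier (-ξ) fun i => (((w i : ℝ) / (n : ℕ) : ℝ) : UnitAddCircle) := by
    intro n
    rw [character]
    congr 1
    funext i
    exact ZMod.toAddCircle_intCast (w i)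
  simp_rw [h1]
  have h2 : Tendsto (fun n : ℕ+ => fun i => (((w i : ℝ) / (n : ℕ) : ℝ) : UnitAddCircle)) atTop
      (𝓝 (fun _ => ((0 : ℝ) : UnitAddCircle))) := by
    rw [tendsto_pi_nhds]
    intro i
    refine ((AddCircle.continuous_mk' 1).tendsto 0).comp ?_
    exact (tendsto_const_div_atTop_nhds_zero_nat _).comp tendsto_PNat_val_atTop_atTop
  have h3 := ((UnitAddTorus.mFourier (-ξ)).continuous.tendsto _).comp h2
  have h4 : UnitAddTorus.mFourier (-ξ) (fun _ : Fin d => ((0 : ℝ) : UnitAddCircle)) = 1 := by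
    simp [UnitAddTorus.mFourier]
  rw [h4] at h3
  exact h3

variable {Kn : ∀ n : ℕ+, DTorus d n → ℝ} {K : (Fin d → ℤ) → ℝ}

theorem sum_abs_kernel_centeredRep_le (hK : Summable fun w => |K w|) (n : ℕ+) :
    ∑ x : DTorus d n, |K (centeredRep x)| ≤ ∑' w, |K w| := by
  have := hK.sum_le_tsum (Finset.univ.map ⟨centeredRep (d := d) (n := n), centeredRep_injective⟩)
    fun _ _ => abs_nonneg _
  rwa [Finset.sum_map] at this

theorem eventually_sum_abs_kernel_le (hK : Summable fun w => |K w|)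
    (hlim : Tendsto (fun n : ℕ+ => ∑ x : DTorus d n, |Kn n x - K (centeredRep x)|) atTop (𝓝 0)) :
    ∀ᶠ n in atTop, ∑ x, |Kn n x| ≤ ∑' w, |K w| + 1 := by
  filter_upwards [hlim.eventually (gt_mem_nhds zero_lt_one)] with n hn
  have h1 : ∑ x, |Kn n x|
      ≤ ∑ x, |Kn n x - K (centeredRep x)| + ∑ x : DTorus d n, |K (centeredRep x)| := by
    rw [← Finset.sum_add_distrib]
    refine Finset.sum_le_sum fun x _ => ?_
    have := abs_add_le (Kn n x - K (centeredRep x)) (K (centeredRep x))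
    rwa [sub_add_cancel] at this
  linarith [sum_abs_kernel_centeredRep_le hK n]

/-- At a fixed frequency the discrete Fourier transforms of the kernels converge to the sum of
the limiting kernel: on the scale of the correlations the frequency `ξ / n` tends to `0`. -/
theorem tendsto_dft_kernel (hK : Summable fun w => |K w|)
    (hlim : Tendsto (fun n : ℕ+ => ∑ x : DTorus d n, |Kn n x - K (centeredRep x)|) atTop (𝓝 0))
    (ξ : Fin d → ℤ) :
    Tendsto (fun n : ℕ+ => dft (Kn n) ξ) atTop (𝓝 ((∑' w, K w : ℝ) : ℂ)) := by
  classical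
  have h1 : Tendsto (fun n : ℕ+ =>
      dft (Kn n) ξ - dft (fun x : DTorus d n => K (centeredRep x)) ξ) atTop (𝓝 0) := by
    refine squeeze_zero_norm (fun n => ?_) hlim
    have : dft (Kn n) ξ - dft (fun x : DTorus d n => K (centeredRep x)) ξ
        = dft (fun x => Kn n x - K (centeredRep x)) ξ := by
      simp only [dft, ← Finset.sum_sub_distrib, Complex.ofReal_sub, sub_mul]
    rw [this]
    exact norm_dft_le _ _
  let F : ℕ+ → (Fin d → ℤ) → ℂ := fun n w =>
    if centeredRep (reduceMod d n w) = w then (K w : ℂ) * character (n : ℕ) ξ (reduceMod d n w)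
    else 0
  have h2 : ∀ n : ℕ+, dft (fun x : DTorus d n => K (centeredRep x)) ξ = ∑' w, F n w := by
    intro n
    rw [← (centeredRep_injective (d := d) (n := n)).tsum_eq, tsum_fintype, dft]
    · refine Finset.sum_congr rfl fun x _ => ?_
      simp only [F, reduceMod_centeredRep, if_true]
    · intro w hw
      by_contra h
      refine hw (if_neg fun h' => h ⟨_, h'⟩)
  have h3 : Tendsto (fun n : ℕ+ => ∑' w, F n w) atTop (𝓝 (∑' w, (K w : ℂ))) := by
    refine tendsto_tsum_of_dominated_convergence hK (fun w => ?_)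
      (Eventually.of_forall fun n w => ?_)
    · have := (tendsto_character_reduceMod ξ w).const_mul (K w : ℂ)
      rw [mul_one] at this
      refine this.congr' ?_
      filter_upwards [tendsto_PNat_val_atTop_atTop.eventually
        (eventually_centeredRep_reduceMod w)] with n hn
      exact (if_pos hn).symm
    · simp only [F]
      split_ifs
      · rw [norm_mul, norm_character, mul_one, Complex.norm_real, Real.norm_eq_abs]
      · simp
  have h4 := h1.add h3
  simp only [← h2, sub_add_cancel, zero_add] at h4
  rw [Complex.ofReal_tsum]
  exact h4

end Kernel

/-! ### The scaling limit -/

section GaussianWeights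

variable {d n : ℕ} [NeZero n] {Ω : Type*} [MeasurableSpace Ω] {P : Measure Ω}
  {σ : Ω → DTorus d n → ℝ}

theorem memLp_two_of_gaussian (hσ : HasGaussianLaw σ P) (L : (DTorus d n → ℝ) →L[ℝ] ℝ) :
    MemLp (fun ω => L (σ ω)) 2 P :=
  (hσ.map_fun L).memLp_two

theorem integral_exp_of_gaussian (hσ : HasGaussianLaw σ P) (hmean : ∀ x, ∫ ω, σ ω x ∂P = 0)
    (L : (DTorus d n → ℝ) →L[ℝ] ℝ) :
    ∫ ω, Complex.exp ((L (σ ω) : ℂ) * Complex.I) ∂P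
      = Complex.exp ((-(∫ ω, L (σ ω) ^ 2 ∂P) / 2 : ℝ) : ℂ) := by
  have hX := hσ.map_fun L
  have h0 : ∫ ω, L (σ ω) ∂P = 0 := by
    have h1 : ∫ ω, σ ω ∂P = 0 := by
      funext x
      have := (ContinuousLinearMap.proj (R := ℝ) (φ := fun _ : DTorus d n => ℝ)
        x).integral_comp_comm hσ.integrable
      simp only [ContinuousLinearMap.proj_apply, hmean] at this
      exact this.symm
    rw [L.integral_comp_comm hσ.integrable, h1, map_zero]
  have h2 : ∫ ω, Complex.exp ((L (σ ω) : ℂ) * Complex.I) ∂P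
      = charFun (P.map fun ω => L (σ ω)) 1 := by
    rw [charFun_apply_real, integral_map hX.aemeasurable (by fun_prop)]
    simp
  rw [h2, hX.map_eq_gaussianReal, charFun_gaussianReal, h0,
    variance_of_integral_eq_zero hX.aemeasurable h0,
    Real.coe_toNNReal _ (integral_nonneg fun ω => sq_nonneg _)]
  congr 1
  push_cast
  ring

/-- The evaluation of a Hartley coefficient of the odometer field as a linear functional of the
weights. -/
def hartleyCoord (n : ℕ) [NeZero n] (hd : 1 ≤ d) (ε : ℝ≥0) (b : ℝ) (ξ : Freq d) :
    (DTorus d n → ℝ) →L[ℝ] ℝ :=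
  (lp.evalCLM ℝ (fun _ : Freq d => ℝ) 2 ξ).comp (hartleyFieldCLM hd ε b)

theorem hartleyCoord_apply (hd : 1 ≤ d) (ε : ℝ≥0) (b : ℝ) (ξ : Freq d) (τ : DTorus d n → ℝ) :
    hartleyCoord n hd ε b ξ τ = hartleyField ε b τ ξ := rfl

theorem integrable_mul_of_gaussian (hσ : HasGaussianLaw σ P) (x y : DTorus d n) :
    Integrable (fun ω => σ ω x * σ ω y) P :=
  (memLp_two_of_gaussian hσ (ContinuousLinearMap.proj x)).integrable_mul
    (memLp_two_of_gaussian hσ (ContinuousLinearMap.proj y))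

theorem integral_hartleyField_mul (hd : 1 ≤ d) (ε : ℝ≥0) (b : ℝ) (hσ : HasGaussianLaw σ P)
    {κ : DTorus d n → ℝ} (hcov : ∀ x y, ∫ ω, σ ω x * σ ω y ∂P = κ (x - y)) (ξ η : Freq d) :
    ∫ ω, hartleyField ε b (σ ω) ξ * hartleyField ε b (σ ω) η ∂P
      = (ξ.len ^ (-2 * (ε : ℝ)) * η.len ^ (-2 * (ε : ℝ)))
        * (b ^ 2 * ((n : ℝ) ^ d)⁻¹) * (odometerSymbol n ξ.1 * odometerSymbol n η.1)
        * ((dft κ ξ.1).re * meanCharacter n (ξ.1 - η.1)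
          + (dft κ ξ.1).im * meanCharacter n (ξ.1 + η.1)) := by
  have hn : ((n : ℝ) ^ d) ≠ 0 := pow_ne_zero _ (Nat.cast_ne_zero.2 (NeZero.ne n))
  have h1 : ∀ ω, hartleyField ε b (σ ω) ξ * hartleyField ε b (σ ω) η
      = ((ξ.len ^ (-2 * (ε : ℝ)) * η.len ^ (-2 * (ε : ℝ)))
        * (b ^ 2 * ((n : ℝ) ^ d)⁻¹ * ((n : ℝ) ^ d)⁻¹)
        * (odometerSymbol n ξ.1 * odometerSymbol n η.1)) * (dht (σ ω) ξ.1 * dht (σ ω) η.1) := by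
    intro ω
    rw [hartleyField_apply hd, hartleyField_apply hd]
    ring
  simp_rw [h1]
  rw [integral_const_mul, integral_dht_mul_dht (integrable_mul_of_gaussian hσ) hcov]
  field_simp

theorem charFun_map_hartleyField (hd : 1 ≤ d) (ε : ℝ≥0) (b : ℝ) (hσ : HasGaussianLaw σ P)
    (hmean : ∀ x, ∫ ω, σ ω x ∂P = 0) (s : Finset (Freq d)) (a : Freq d → ℝ) :
    charFun (P.map fun ω => hartleyField ε b (σ ω)) (∑ ξ ∈ s, a ξ • coordBasis d ξ)
      = Complex.exp ((-(∑ ξ ∈ s, ∑ η ∈ s, a ξ * a η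
          * ∫ ω, hartleyField ε b (σ ω) ξ * hartleyField ε b (σ ω) η ∂P) / 2 : ℝ) : ℂ) := by
  have hmeas : AEMeasurable (fun ω => hartleyField ε b (σ ω)) P :=
    (hartleyFieldCLM (n := n) hd ε b).continuous.measurable.comp_aemeasurable hσ.aemeasurable
  let L : (DTorus d n → ℝ) →L[ℝ] ℝ := ∑ ξ ∈ s, a ξ • hartleyCoord n hd ε b ξ
  have hL : ∀ τ, L τ = ∑ ξ ∈ s, a ξ * hartleyField ε b τ ξ := by
    intro τ
    simp [L, hartleyCoord_apply]
  have h1 : ∀ τ : DTorus d n → ℝ,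
      inner ℝ (hartleyField ε b τ) (∑ ξ ∈ s, a ξ • coordBasis d ξ) = L τ := by
    intro τ
    rw [hL, inner_sum]
    refine Finset.sum_congr rfl fun ξ _ => ?_
    rw [real_inner_smul_right, real_inner_comm, inner_coordBasis]
  rw [charFun_apply, integral_map hmeas (by fun_prop)]
  simp_rw [h1]
  rw [integral_exp_of_gaussian hσ hmean]
  refine congrArg (fun t : ℝ => Complex.exp ((-t / 2 : ℝ) : ℂ)) ?_
  have hint : ∀ ξ η : Freq d, Integrable
      (fun ω => hartleyField ε b (σ ω) ξ * hartleyField ε b (σ ω) η) P := fun ξ η =>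
    (memLp_two_of_gaussian hσ (hartleyCoord n hd ε b ξ)).integrable_mul
      (memLp_two_of_gaussian hσ (hartleyCoord n hd ε b η))
  have h2 : ∀ ω, L (σ ω) ^ 2 = ∑ ξ ∈ s, ∑ η ∈ s, a ξ * a η
      * (hartleyField ε b (σ ω) ξ * hartleyField ε b (σ ω) η) := by
    intro ω
    rw [hL, sq, Finset.sum_mul_sum]
    refine Finset.sum_congr rfl fun ξ _ => Finset.sum_congr rfl fun η _ => ?_
    ring
  simp_rw [h2]
  rw [integral_finsetSum _ fun ξ _ => integrable_finsetSum _ fun η _ => (hint ξ η).const_mul _]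
  refine Finset.sum_congr rfl fun ξ _ => ?_
  rw [integral_finsetSum _ fun η _ => (hint ξ η).const_mul _]
  exact Finset.sum_congr rfl fun η _ => integral_const_mul _ _

end GaussianWeights

section Limit

variable {d : ℕ}

/-- The sum of the limiting kernel is a limit of variances of normalized total weights. -/
theorem tsum_kernel_nonneg {Ω : ℕ+ → Type*} [∀ n, MeasurableSpace (Ω n)]
    {P : ∀ n, Measure (Ω n)} {σ : ∀ n : ℕ+, Ω n → DTorus d n → ℝ}
    (hσ : ∀ n, HasGaussianLaw (σ n) (P n))
    {Kn : ∀ n : ℕ+, DTorus d n → ℝ}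
    (hcov : ∀ (n : ℕ+) (x y : DTorus d n), ∫ ω, σ n ω x * σ n ω y ∂(P n) = Kn n (x - y))
    {K : (Fin d → ℤ) → ℝ} (hK : Summable fun w => |K w|)
    (hlim : Tendsto (fun n : ℕ+ => ∑ x : DTorus d n, |Kn n x - K (centeredRep x)|) atTop (𝓝 0)) :
    0 ≤ ∑' w, K w := by
  have h1 := (Complex.continuous_re.tendsto _).comp (tendsto_dft_kernel hK hlim 0)
  rw [Complex.ofReal_re] at h1
  refine ge_of_tendsto' h1 fun n => ?_
  have hn : (0 : ℝ) < ((n : ℕ) : ℝ) ^ d := pow_pos (Nat.cast_pos.2 n.pos) _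
  have h2 := integral_dht_mul_dht (integrable_mul_of_gaussian (hσ n)) (hcov n) 0 0
  have h3 : (dft (Kn n) 0).im = 0 := by
    have := dft_neg_freq (Kn n) 0
    rw [neg_zero] at this
    exact Complex.conj_eq_iff_im.1 this.symm
  rw [h3, sub_zero, meanCharacter_zero, zero_mul, add_zero, mul_one] at h2
  have h4 : 0 ≤ ((n : ℕ) : ℝ) ^ d * (dft (Kn n) 0).re := by
    rw [← h2]
    exact integral_nonneg fun ω => mul_self_nonneg _
  exact nonneg_of_mul_nonneg_right h4 hn

/-- The squared normalization times the factor `n⁻ᵈ` of the covariances is of order `n⁻⁴`, which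
compensates the growth of the inverse Laplacian. -/
theorem scaling_sq (c₁ c₂ : ℝ) (n : ℕ+) :
    (c₁ * ((n : ℕ) : ℝ) ^ (((d : ℝ) - 4) / 2) * c₂) ^ 2 * (((n : ℕ) : ℝ) ^ d)⁻¹
      = (c₁ * c₂) ^ 2 * ((((n : ℕ) : ℝ) ^ 2)⁻¹ * (((n : ℕ) : ℝ) ^ 2)⁻¹) := by
  have hn : (0 : ℝ) < ((n : ℕ) : ℝ) := Nat.cast_pos.2 n.pos
  have h1 : (((n : ℕ) : ℝ) ^ (((d : ℝ) - 4) / 2)) ^ 2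
      = ((n : ℕ) : ℝ) ^ d * ((((n : ℕ) : ℝ) ^ 2)⁻¹ * (((n : ℕ) : ℝ) ^ 2)⁻¹) := by
    rw [← Real.rpow_natCast (((n : ℕ) : ℝ) ^ (((d : ℝ) - 4) / 2)) 2, ← Real.rpow_mul hn.le,
      show ((d : ℝ) - 4) / 2 * ((2 : ℕ) : ℝ) = (d : ℝ) - (4 : ℕ) by push_cast; ring,
      Real.rpow_sub hn, Real.rpow_natCast, Real.rpow_natCast, div_eq_mul_inv, ← mul_inv]
    ring
  rw [mul_pow, mul_pow, h1]
  field_simp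

/-- Convergence of the covariances of the Hartley coefficients, `c` being the constant in the
normalization `b_n = c n^((d-4)/2)`. -/
theorem tendsto_covariance (hd : 1 ≤ d) (ε : ℝ≥0) {Kn : ∀ n : ℕ+, DTorus d n → ℝ}
    {K : (Fin d → ℤ) → ℝ} (hK : Summable fun w => |K w|)
    (hlim : Tendsto (fun n : ℕ+ => ∑ x : DTorus d n, |Kn n x - K (centeredRep x)|) atTop (𝓝 0))
    {c : ℝ} (hc : c ^ 2 * ∑' w, K w = (2 * Real.pi ^ 2 / d) ^ 2) (ξ η : Freq d) :
    Tendsto (fun n : ℕ+ => (ξ.len ^ (-2 * (ε : ℝ)) * η.len ^ (-2 * (ε : ℝ)))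
        * (c ^ 2 * ((((n : ℕ) : ℝ) ^ 2)⁻¹ * (((n : ℕ) : ℝ) ^ 2)⁻¹))
        * (odometerSymbol n ξ.1 * odometerSymbol n η.1)
        * ((dft (Kn n) ξ.1).re * meanCharacter n (ξ.1 - η.1)
          + (dft (Kn n) ξ.1).im * meanCharacter n (ξ.1 + η.1))) atTop
      (𝓝 (if ξ = η then (ξ.len ^ (-2 - 2 * (ε : ℝ))) ^ 2 else 0)) := by
  have hodo : ∀ ζ : Freq d, Tendsto (fun n : ℕ+ => odometerSymbol n ζ.1 / ((n : ℕ) : ℝ) ^ 2) atTop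
      (𝓝 ((d : ℝ) / (2 * Real.pi ^ 2) * (ζ.len ^ 2)⁻¹)) := fun ζ =>
    (tendsto_odometerSymbol hd ζ).comp tendsto_PNat_val_atTop_atTop
  have hre := (Complex.continuous_re.tendsto _).comp (tendsto_dft_kernel hK hlim ξ.1)
  have him := (Complex.continuous_im.tendsto _).comp (tendsto_dft_kernel hK hlim ξ.1)
  rw [Complex.ofReal_re] at hre
  rw [Complex.ofReal_im] at him
  have hmean : Tendsto (fun n : ℕ+ => meanCharacter n (ξ.1 - η.1)) atTop
      (𝓝 (if ξ = η then 1 else 0)) := by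
    split_ifs with h
    · subst h
      simp only [sub_self, meanCharacter_zero]
      exact tendsto_const_nhds
    · refine tendsto_const_nhds.congr' ?_
      filter_upwards [tendsto_PNat_val_atTop_atTop.eventually (eventually_meanCharacter_eq_zero
        (ξ := ξ.1 - η.1) (sub_ne_zero.2 fun h' => h (Subtype.ext h')))] with n hn
      exact hn.symm
  have him' : Tendsto (fun n : ℕ+ => (dft (Kn n) ξ.1).im * meanCharacter n (ξ.1 + η.1)) atTop
      (𝓝 0) := by
    refine squeeze_zero_norm (fun n => ?_) (tendsto_norm_zero.comp him)
    rw [norm_mul]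
    exact mul_le_of_le_one_right (norm_nonneg _) (abs_meanCharacter_le_one _ _)
  have hall := ((((hodo ξ).mul (hodo η)).const_mul
    ((ξ.len ^ (-2 * (ε : ℝ)) * η.len ^ (-2 * (ε : ℝ))) * c ^ 2))).mul ((hre.mul hmean).add him')
  refine (hall.congr fun n => ?_).trans (le_of_eq ?_)
  · simp only [Function.comp, div_eq_mul_inv]
    ring
  · congr 1
    split_ifs with h
    · subst h
      have hd' : (d : ℝ) ≠ 0 := by positivity
      have hpi := Real.pi_ne_zero
      have hlen := ξ.len_pos
      rw [sub_eq_add_neg, Real.rpow_add hlen, show -(2 * (ε : ℝ)) = -2 * ε by ring,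
        show (-2 : ℝ) = -((2 : ℕ) : ℝ) by norm_num, Real.rpow_neg hlen.le, Real.rpow_natCast]
      rw [mul_one, add_zero]
      have hC : c ^ 2 * ∑' w, K w * ((d : ℝ) / (2 * Real.pi ^ 2)) ^ 2 = 1 := by
        rw [tsum_mul_right, ← mul_assoc, hc]
        field_simp
      rw [tsum_mul_right] at hC
      linear_combination
        (ξ.len ^ (-((2 : ℕ) : ℝ) * (ε : ℝ))) ^ 2 * ((ξ.len ^ 2)⁻¹) ^ 2 * hC
    · ring

variable {Ω : ℕ+ → Type*} [∀ n, MeasurableSpace (Ω n)]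
    {P : ∀ n, Measure (Ω n)} {σ : ∀ n : ℕ+, Ω n → DTorus d n → ℝ} {Kn : ∀ n : ℕ+, DTorus d n → ℝ}
    {K : (Fin d → ℤ) → ℝ}

/-- Uniform bound on the variances of the Hartley coefficients, valid at all frequencies. -/
theorem eventually_lintegral_sq_le (hd : 1 ≤ d) (ε : ℝ≥0)
    (hσ : ∀ n, HasGaussianLaw (σ n) (P n))
    (hcov : ∀ (n : ℕ+) (x y : DTorus d n), ∫ ω, σ n ω x * σ n ω y ∂(P n) = Kn n (x - y))
    (hK : Summable fun w => |K w|)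
    (hlim : Tendsto (fun n : ℕ+ => ∑ x : DTorus d n, |Kn n x - K (centeredRep x)|) atTop (𝓝 0))
    (c₁ c₂ : ℝ) :
    ∃ M : ℝ, 0 ≤ M ∧ ∀ᶠ n : ℕ+ in atTop, ∀ ξ : Freq d,
      ∫⁻ ω, ENNReal.ofReal
          (hartleyField ε (c₁ * ((n : ℕ) : ℝ) ^ (((d : ℝ) - 4) / 2) * c₂) (σ n ω) ξ ^ 2) ∂(P n)
        ≤ ENNReal.ofReal (M * ξ.len ^ (-4 * (ε : ℝ))) := by
  have hM : 0 ≤ ∑' w, |K w| + 1 := add_nonneg (tsum_nonneg fun _ => abs_nonneg _) zero_le_one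
  refine ⟨(c₁ * c₂) ^ 2 * ((d : ℝ) / 8) ^ 2 * (2 * (∑' w, |K w| + 1)), by positivity, ?_⟩
  filter_upwards [eventually_sum_abs_kernel_le hK hlim] with n hn ξ
  have hn0 : (0 : ℝ) < ((n : ℕ) : ℝ) := Nat.cast_pos.2 n.pos
  set b : ℝ := c₁ * ((n : ℕ) : ℝ) ^ (((d : ℝ) - 4) / 2) * c₂ with hb
  have hint := (memLp_two_of_gaussian (hσ n) (hartleyCoord n hd ε b ξ)).integrable_sq
  simp only [hartleyCoord_apply] at hint
  rw [← ofReal_integral_eq_lintegral_ofReal hint (Eventually.of_forall fun _ => sq_nonneg _)]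
  refine ENNReal.ofReal_le_ofReal ?_
  simp only [sq (hartleyField _ _ _ _)]
  rw [integral_hartleyField_mul hd ε b (hσ n) (hcov n), hb, scaling_sq]
  have h1 : |(dft (Kn n) ξ.1).re * meanCharacter n (ξ.1 - ξ.1)
      + (dft (Kn n) ξ.1).im * meanCharacter n (ξ.1 + ξ.1)| ≤ 2 * (∑' w, |K w| + 1) := by
    have hnorm := (norm_dft_le (Kn n) ξ.1).trans hn
    refine (abs_add_le _ _).trans ?_
    rw [abs_mul, abs_mul, two_mul]
    refine add_le_add ?_ ?_
    · exact (mul_le_of_le_one_right (abs_nonneg _) (abs_meanCharacter_le_one _ _)).trans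
        ((Complex.abs_re_le_norm _).trans hnorm)
    · exact (mul_le_of_le_one_right (abs_nonneg _) (abs_meanCharacter_le_one _ _)).trans
        ((Complex.abs_im_le_norm _).trans hnorm)
  have h2 : (odometerSymbol n ξ.1 * (((n : ℕ) : ℝ) ^ 2)⁻¹) ^ 2 ≤ ((d : ℝ) / 8) ^ 2 := by
    have h3 := abs_odometerSymbol_le (n := n) hd ξ.2
    have h4 : |odometerSymbol n ξ.1 * (((n : ℕ) : ℝ) ^ 2)⁻¹| ≤ (d : ℝ) / 8 := by
      rw [abs_mul, abs_of_pos (a := (((n : ℕ) : ℝ) ^ 2)⁻¹) (by positivity), ← div_eq_mul_inv,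
        div_le_iff₀ (by positivity)]
      linarith
    exact sq_le_sq' (abs_le.1 h4).1 (abs_le.1 h4).2
  have h5 : ξ.len ^ (-2 * (ε : ℝ)) * ξ.len ^ (-2 * (ε : ℝ)) = ξ.len ^ (-4 * (ε : ℝ)) := by
    rw [← Real.rpow_add ξ.len_pos]
    congr 1
    ring
  have h6 := (Real.rpow_pos_of_pos ξ.len_pos (-4 * (ε : ℝ))).le
  rw [h5]
  calc _ = (c₁ * c₂) ^ 2 * (odometerSymbol n ξ.1 * (((n : ℕ) : ℝ) ^ 2)⁻¹) ^ 2
        * ((dft (Kn n) ξ.1).re * meanCharacter n (ξ.1 - ξ.1)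
          + (dft (Kn n) ξ.1).im * meanCharacter n (ξ.1 + ξ.1)) * ξ.len ^ (-4 * (ε : ℝ)) := by ring
    _ ≤ _ := by
      refine mul_le_mul_of_nonneg_right ?_ h6
      refine (mul_le_mul_of_nonneg_left ((le_abs_self _).trans h1) (by positivity)).trans ?_
      exact mul_le_mul_of_nonneg_right (mul_le_mul_of_nonneg_left h2 (sq_nonneg _)) (by positivity)

end Limit

end Sandpile

end

theorem mainTheorem2 (d : ℕ) (hd : 1 ≤ d)
    -- the weights, for each side length `n`, on some probability space
    (Ω : ℕ+ → Type*) [∀ n, MeasurableSpace (Ω n)]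
    (P : ∀ n, Measure (Ω n)) [∀ n, IsProbabilityMeasure (P n)]
    (σ : ∀ n : ℕ+, Ω n → Sandpile.DTorus d n → ℝ)
    (hσ_gauss : ∀ n, HasGaussianLaw (σ n) (P n))
    (hσ_mean : ∀ (n : ℕ+) (x : Sandpile.DTorus d n), ∫ ω, σ n ω x ∂(P n) = 0)
    -- their covariance
    (Kn : ∀ n : ℕ+, Sandpile.DTorus d n → ℝ)
    (hσ_cov : ∀ (n : ℕ+) (x y : Sandpile.DTorus d n),
      ∫ ω, σ n ω x * σ n ω y ∂(P n) = Kn n (x - y))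
    -- the limiting kernel
    (K : (Fin d → ℤ) → ℝ)
    (hK_sum : Summable fun w => |K w|)
    (hK_lim : Tendsto (fun n : ℕ+ => ∑ x : Sandpile.DTorus d n,
      |Kn n x - K (Sandpile.centeredRep x)|) atTop (𝓝 0))
    (hK_ne : ∑' w, K w ≠ 0)
    (ε : ℝ≥0) (hε : max ((d : ℝ) / 2) ((d : ℝ) / 4 + 1) < ε) :
    -- stabilization: the total emitted mass is finite
    (∀ (n : ℕ+) (ω : Ω n) (x : Sandpile.DTorus d n),
      Summable fun t => Sandpile.emitted (Sandpile.initialConfig (σ n ω)) t x) ∧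
    -- the scaling limit
    ∃ μ : ProbabilityMeasure (Sandpile.NegSobolev d ε),
      Sandpile.IsFGF2 (μ : Measure (Sandpile.NegSobolev d ε)) ∧
      TendstoInDistribution
        (fun (n : ℕ+) (ω : Ω n) =>
          (4 * Real.pi ^ 2 * (2 * (d : ℝ))⁻¹ * ((n : ℕ) : ℝ) ^ (((d : ℝ) - 4) / 2)
              * (∑' w, K w) ^ (-(1 / 2) : ℝ)) •
            Sandpile.field ε (Sandpile.odometer (Sandpile.initialConfig (σ n ω))))
        atTop id P (μ : Measure (Sandpile.NegSobolev d ε)) := by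
  classical
  refine ⟨fun n ω x => ?_, ?_⟩
  · obtain ⟨v, hv, hs⟩ := Sandpile.exists_nonneg_lap_eq hd
      (Sandpile.sum_initialConfig_sub_one (σ n ω))
    exact Sandpile.summable_emitted hv (fun y => (hs y).le) x
  have hε' : (d : ℝ) / 4 < ε := by
    have h1 := (le_max_left _ _).trans_lt hε
    have h2 : (0 : ℝ) ≤ d := Nat.cast_nonneg d
    linarith
  have hCpos : 0 < ∑' w, K w :=
    (Sandpile.tsum_kernel_nonneg hσ_gauss hσ_cov hK_sum hK_lim).lt_of_ne' hK_ne
  set c₁ : ℝ := 4 * Real.pi ^ 2 * (2 * (d : ℝ))⁻¹ with hc₁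
  set c₂ : ℝ := (∑' w, K w) ^ (-(1 / 2) : ℝ) with hc₂
  -- `c₁ = 2π² / d` cancels the constant in the inverse Laplacian, `c₂` the limiting variance
  have hc : (c₁ * c₂) ^ 2 * ∑' w, K w = (2 * Real.pi ^ 2 / d) ^ 2 := by
    have h1 : c₂ ^ 2 * ∑' w, K w = 1 := by
      rw [hc₂, ← Real.rpow_natCast, ← Real.rpow_mul hCpos.le]
      norm_num
      rw [Real.rpow_neg_one]
      exact inv_mul_cancel₀ hCpos.ne'
    rw [mul_pow, mul_assoc, h1, mul_one, hc₁]
    congr 1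
    field_simp
    norm_num
  let b : ℕ+ → ℝ := fun n => c₁ * ((n : ℕ) : ℝ) ^ (((d : ℝ) - 4) / 2) * c₂
  let Y : ∀ n : ℕ+, Ω n → Sandpile.RealEllTwo d := fun n ω => Sandpile.hartleyField ε (b n) (σ n ω)
  have hY : ∀ n, AEMeasurable (Y n) (P n) := fun n =>
    (Sandpile.hartleyFieldCLM (n := n) hd ε (b n)).continuous.measurable.comp_aemeasurable
      (hσ_gauss n).aemeasurable
  obtain ⟨ν, hνchar, hνFGF⟩ := Sandpile.exists_hartley_FGF2 hε'
  have hΨ : Continuous (Sandpile.ofHartley d ε) := (Sandpile.ofHartley d ε).continuous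
  refine ⟨ν.map hΨ.aemeasurable, hνFGF, ?_⟩
  let law : ℕ+ → ProbabilityMeasure (Sandpile.RealEllTwo d) := fun n =>
    ⟨(P n).map (Y n), Measure.isProbabilityMeasure_map (hY n)⟩
  have hlaw : Tendsto law atTop (𝓝 ν) := by
    obtain ⟨M, hM, hmom⟩ := Sandpile.eventually_lintegral_sq_le hd ε hσ_gauss hσ_cov hK_sum hK_lim
      c₁ c₂
    refine Sandpile.tendsto_of_tendsto_charFun_of_moment_le (Sandpile.coordBasis d) ?_
      ((Sandpile.Freq.summable_len_rpow_neg_four_mul hε').mul_left M)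
      (fun ξ => mul_nonneg hM (Real.rpow_pos_of_pos ξ.len_pos _).le) ?_
    · intro s a
      have h1 : ∀ n, charFun (law n : Measure (Sandpile.RealEllTwo d))
          (∑ ξ ∈ s, a ξ • Sandpile.coordBasis d ξ)
          = Complex.exp ((-(∑ ξ ∈ s, ∑ η ∈ s, a ξ * a η
            * ∫ ω, Y n ω ξ * Y n ω η ∂(P n)) / 2 : ℝ) : ℂ) := fun n =>
        Sandpile.charFun_map_hartleyField hd ε (b n) (hσ_gauss n) (hσ_mean n) s a
      have h2 : ∀ ξ : Sandpile.Freq d, (∑ η ∈ s, a η • Sandpile.coordBasis d η) ξ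
          = if ξ ∈ s then a ξ else 0 := by
        intro ξ
        rw [← Sandpile.inner_coordBasis, inner_sum]
        simp only [real_inner_smul_right,
          orthonormal_iff_ite.1 (Sandpile.coordBasis d).orthonormal, mul_ite, mul_one, mul_zero,
          Finset.sum_ite_eq]
      have h3 : ∑' ξ : Sandpile.Freq d, (ξ.len ^ (-2 - 2 * (ε : ℝ))
          * (∑ η ∈ s, a η • Sandpile.coordBasis d η) ξ) ^ 2
          = ∑ ξ ∈ s, ∑ η ∈ s, a ξ * a η
            * (if ξ = η then (ξ.len ^ (-2 - 2 * (ε : ℝ))) ^ 2 else 0) := by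
        rw [tsum_eq_sum (s := s)]
        · refine Finset.sum_congr rfl fun ξ hξ => ?_
          simp only [h2, if_pos hξ, mul_ite, mul_zero, Finset.sum_ite_eq]
          ring
        · intro ξ hξ
          rw [h2, if_neg hξ, mul_zero]
          exact zero_pow two_ne_zero
      rw [hνchar, h3]
      simp only [h1]
      refine ((by fun_prop : Continuous fun t : ℝ => Complex.exp ((-t / 2 : ℝ) : ℂ)).tendsto
        _).comp ?_
      refine tendsto_finsetSum _ fun ξ _ => tendsto_finsetSum _ fun η _ => Tendsto.const_mul _ ?_
      refine (Sandpile.tendsto_covariance hd ε hK_sum hK_lim hc ξ η).congr fun n => ?_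
      rw [← Sandpile.scaling_sq c₁ c₂ n]
      exact (Sandpile.integral_hartleyField_mul hd ε (b n) (hσ_gauss n) (hσ_cov n) ξ η).symm
    · filter_upwards [hmom] with n hn ξ
      change ∫⁻ y, _ ∂((P n).map (Y n)) ≤ _
      rw [lintegral_map' (by fun_prop) (hY n)]
      simp only [Sandpile.inner_coordBasis]
      exact hn ξ
  -- transport the convergence from the Hartley coordinates to the Sobolev space
  have hX : ∀ n ω, b n • Sandpile.field ε (Sandpile.odometer (Sandpile.initialConfig (σ n ω)))
      = Sandpile.ofHartley d ε (Y n ω) := fun n ω => (Sandpile.ofHartley_toHartley _).symm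
  have hXmeas : ∀ n, AEMeasurable
      (fun ω => b n • Sandpile.field ε (Sandpile.odometer (Sandpile.initialConfig (σ n ω))))
      (P n) := by
    intro n
    simp_rw [hX]
    exact hΨ.measurable.comp_aemeasurable (hY n)
  refine ⟨hXmeas, aemeasurable_id, ?_⟩
  have h1 := ProbabilityMeasure.tendsto_map_of_tendsto_of_continuous law ν hlaw hΨ
  have h2 : ∀ n, (law n).map hΨ.aemeasurable
      = ⟨(P n).map fun ω => b n • Sandpile.field ε
          (Sandpile.odometer (Sandpile.initialConfig (σ n ω))),
        Measure.isProbabilityMeasure_map (hXmeas n)⟩ := by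
    intro n
    apply Subtype.ext
    change ((P n).map (Y n)).map _ = (P n).map _
    simp_rw [hX]
    rw [AEMeasurable.map_map_of_aemeasurable hΨ.aemeasurable (hY n)]
    rfl
  have h3 : (⟨((ν.map hΨ.aemeasurable : ProbabilityMeasure (Sandpile.NegSobolev d ε)) :
      Measure (Sandpile.NegSobolev d ε)).map id,
      Measure.isProbabilityMeasure_map aemeasurable_id⟩ :
        ProbabilityMeasure (Sandpile.NegSobolev d ε)) = ν.map hΨ.aemeasurable :=
    Subtype.ext Measure.map_id
  rw [h3]
  exact h1.congr h2
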